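/- Let $k$ be an algebraically closed field of characteristic $0$, let $C$ be a smooth irreducible projective curve over $k$, let $E$ be a vector bundle of rank $2$ on $C$, and let $\pi\colon X=\mathbb{P}_C(E)=\mathrm{Proj}(\mathrm{Sym}\,E)\to C$ be the associated ruled surface. Write $\Omega^1_C=\Omega^1_{C/k}$ and $\Omega^1_X=\Omega^1_{X/k}$ for the sheaves of Kähler differentials, and let $\eta\colon\Omega^1_C\to\pi_*(\Omega^1_X)$ be the natural map, that is, the $\mathcal{O}_C$-linear map with $\eta(df)=d(\pi^{\#}f)$ for every local section $f$ of $\mathcal{O}_C$ (the adjoint of the pullback of differentials $\pi^*\Omega^1_C\to\Omega^1_X$). Then $\eta$ is an isomorphism of $\mathcal{O}_C$-modules. -/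

import Mathlib

open CategoryTheory Limits AlgebraicGeometry TopologicalSpace

universe u

namespace RuledSurface

noncomputable section

/-! ### The grading of the symmetric algebra -/

section Sym

variable (R M : Type u) [CommRing R] [AddCommGroup M] [Module R M]

/-- The degree `n` part `Symⁿ M` of the symmetric algebra: the span of the `n`-fold products of
elements of `M`. -/
def symGrading (n : ℕ) : Submodule R (SymmetricAlgebra R M) :=
  (LinearMap.range (SymmetricAlgebra.ι R M)) ^ n

instance : SetLike.GradedMonoid (symGrading R M) :=
  Submodule.nat_power_gradedMonoid (LinearMap.range (SymmetricAlgebra.ι R M))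

variable {R M} in
lemma ι_mem_symGrading (m : M) : SymmetricAlgebra.ι R M m ∈ symGrading R M 1 := by
  rw [symGrading, pow_one]; exact LinearMap.mem_range_self _ m

/-- The inclusion of `M` into the direct sum of the graded pieces of its symmetric algebra. -/
def symGradedι : M →ₗ[R] DirectSum ℕ fun i => symGrading R M i :=
  DirectSum.lof R ℕ (fun i => symGrading R M i) 1 ∘ₗ
    (SymmetricAlgebra.ι R M).codRestrict _ ι_mem_symGrading

lemma symGradedι_apply (m : M) : symGradedι R M m =
    DirectSum.of (fun i => symGrading R M i) 1 ⟨SymmetricAlgebra.ι R M m, ι_mem_symGrading m⟩ :=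
  rfl

lemma lift_symGradedι_eq (i : ℕ) (x : symGrading R M i) :
    SymmetricAlgebra.lift (symGradedι R M) x = DirectSum.of (fun i => symGrading R M i) i x := by
  obtain ⟨x, hx⟩ := x
  dsimp only
  induction hx using Submodule.pow_induction_on_left' with
  | algebraMap r => rw [AlgHom.commutes, DirectSum.algebraMap_apply]; rfl
  | add x y i hx hy ihx ihy =>
    rw [map_add, ihx, ihy, ← map_add]
    rfl
  | mem_mul m hm i x hx ih =>
    obtain ⟨_, rfl⟩ := hm
    rw [map_mul, ih, SymmetricAlgebra.lift_ι_apply, symGradedι_apply, DirectSum.of_mul_of]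
    exact DirectSum.of_eq_of_gradedMonoid_eq (Sigma.subtype_ext (add_comm _ _) rfl)

instance : GradedAlgebra (symGrading R M) :=
  GradedAlgebra.ofAlgHom _ (SymmetricAlgebra.lift (symGradedι R M))
    (by
      refine SymmetricAlgebra.algHom_ext (LinearMap.ext fun m => ?_)
      change DirectSum.coeAlgHom (symGrading R M)
        (SymmetricAlgebra.lift (symGradedι R M) (SymmetricAlgebra.ι R M m)) =
          SymmetricAlgebra.ι R M m
      rw [SymmetricAlgebra.lift_ι_apply, symGradedι_apply, DirectSum.coeAlgHom_of])
    (lift_symGradedι_eq R M)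

end Sym

section SymMap

variable {R S : Type u} [CommRing R] [CommRing S] {M N : Type u} [AddCommGroup M] [Module R M]
  [AddCommGroup N] [Module S N]

lemma sym_ringHom_ext {A : Type*} [CommRing A] {φ ψ : SymmetricAlgebra R M →+* A}
    (h₁ : ∀ r, φ (algebraMap R _ r) = ψ (algebraMap R _ r))
    (h₂ : ∀ m, φ (SymmetricAlgebra.ι R M m) = ψ (SymmetricAlgebra.ι R M m)) : φ = ψ := by
  refine RingHom.ext fun a => ?_
  induction a using SymmetricAlgebra.induction with
  | algebraMap r => exact h₁ r
  | ι x => exact h₂ x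
  | mul a b ha hb => rw [map_mul, map_mul, ha, hb]
  | add a b ha hb => rw [map_add, map_add, ha, hb]

variable (σ : R →+* S) (f : M →ₛₗ[σ] N)

/-- The ring homomorphism `Sym_R M → Sym_S N` induced by a semilinear map `M → N`. -/
def symMapRingHom : SymmetricAlgebra R M →+* SymmetricAlgebra S N :=
  letI : Algebra R (SymmetricAlgebra S N) :=
    ((algebraMap S (SymmetricAlgebra S N)).comp σ).toAlgebra
  (SymmetricAlgebra.lift (R := R) (M := M) (A := SymmetricAlgebra S N)
    { toFun := fun m => SymmetricAlgebra.ι S N (f m)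
      map_add' := fun x y => by simp
      map_smul' := fun r x => by
        rw [map_smulₛₗ, map_smul, Algebra.smul_def]
        rfl }).toRingHom

@[simp] lemma symMapRingHom_algebraMap (r : R) :
    symMapRingHom σ f (algebraMap R _ r) = algebraMap S _ (σ r) := by
  let _ : Algebra R (SymmetricAlgebra S N) :=
    ((algebraMap S (SymmetricAlgebra S N)).comp σ).toAlgebra
  exact AlgHom.commutes (SymmetricAlgebra.lift (R := R) (M := M) (A := SymmetricAlgebra S N) _) r

@[simp] lemma symMapRingHom_ι (m : M) :
    symMapRingHom σ f (SymmetricAlgebra.ι R M m) = SymmetricAlgebra.ι S N (f m) := by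
  let _ : Algebra R (SymmetricAlgebra S N) :=
    ((algebraMap S (SymmetricAlgebra S N)).comp σ).toAlgebra
  exact SymmetricAlgebra.lift_ι_apply (R := R) (M := M) (A := SymmetricAlgebra S N) _ m

lemma symMapRingHom_mem {n : ℕ} {x : SymmetricAlgebra R M} (hx : x ∈ symGrading R M n) :
    symMapRingHom σ f x ∈ symGrading S N n := by
  induction hx using Submodule.pow_induction_on_left' with
  | algebraMap r => 
    rw [symMapRingHom_algebraMap, symGrading, pow_zero]
    exact Submodule.algebraMap_mem _
  | add x y i hx hy ihx ihy => rw [map_add]; exact add_mem ihx ihy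
  | mem_mul m hm i x hx ih =>
    obtain ⟨m, rfl⟩ := hm
    rw [map_mul, symMapRingHom_ι, Nat.succ_eq_add_one, add_comm]
    exact SetLike.mul_mem_graded (ι_mem_symGrading _) ih

/-- The graded ring homomorphism `Sym_R M → Sym_S N` induced by a semilinear map `M → N`. -/
def symMap : GradedRingHom (symGrading R M) (symGrading S N) where
  toRingHom := symMapRingHom σ f
  map_mem := symMapRingHom_mem σ f

@[simp] lemma symMap_algebraMap (r : R) :
    symMap σ f (algebraMap R _ r) = algebraMap S _ (σ r) := symMapRingHom_algebraMap σ f r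

@[simp] lemma symMap_ι (m : M) :
    symMap σ f (SymmetricAlgebra.ι R M m) = SymmetricAlgebra.ι S N (f m) := symMapRingHom_ι σ f m

/-- The irrelevant ideal of `Sym M` is generated by any spanning set of `M`. -/
lemma irrelevant_le_span {κ : Type*} (b : κ → M) (hb : Submodule.span R (Set.range b) = ⊤) :
    (HomogeneousIdeal.irrelevant (symGrading R M)).toIdeal ≤
      Ideal.span (Set.range fun i => SymmetricAlgebra.ι R M (b i)) := by
  have key : ∀ m, SymmetricAlgebra.ι R M m ∈
      Ideal.span (Set.range fun i => SymmetricAlgebra.ι R M (b i)) := by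
    intro m
    have hm : m ∈ Submodule.span R (Set.range b) := hb ▸ Submodule.mem_top
    induction hm using Submodule.span_induction with
    | mem x hx => obtain ⟨i, rfl⟩ := hx; exact Ideal.subset_span ⟨i, rfl⟩
    | zero => simp
    | add x y _ _ hx hy => rw [map_add]; exact add_mem hx hy
    | smul r x _ hx => rw [map_smul, Algebra.smul_def]; exact Ideal.mul_mem_left _ _ hx
  rw [HomogeneousIdeal.toIdeal_irrelevant_le]
  intro i hi x hx
  obtain ⟨n, rfl⟩ : ∃ n, i = n + 1 := ⟨i - 1, by omega⟩
  have hx' : x ∈ LinearMap.range (SymmetricAlgebra.ι R M) *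
      LinearMap.range (SymmetricAlgebra.ι R M) ^ n := by
    rw [← pow_succ']; exact hx
  clear hx
  induction hx' using Submodule.mul_induction_on' with
  | mem_mul_mem m hm n hn => obtain ⟨m, rfl⟩ := hm; exact Ideal.mul_mem_right _ _ (key m)
  | add x hx y hy ihx ihy => exact add_mem ihx ihy

lemma irrelevant_le_map (hf : Submodule.span S (Set.range f) = ⊤) :
    HomogeneousIdeal.irrelevant (symGrading S N) ≤
      (HomogeneousIdeal.irrelevant (symGrading R M)).map (symMap σ f) := by
  refine (irrelevant_le_span f hf).trans ?_
  rw [Ideal.span_le]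
  rintro _ ⟨m, rfl⟩
  change SymmetricAlgebra.ι S N (f m) ∈ _
  rw [← symMap_ι]
  exact Ideal.mem_map_of_mem _
    (HomogeneousIdeal.mem_irrelevant_of_mem _ one_pos (ι_mem_symGrading m))

end SymMap

/-! ### Charts of `Proj (Sym M)` -/

section Chart

open HomogeneousLocalization

variable {R S : Type u} [CommRing R] [CommRing S] {M N : Type u} [AddCommGroup M] [Module R M]
  [AddCommGroup N] [Module S N]

/-- The structure map `R → (Sym M)_(x)` of a chart. -/
def awayBase (x : SymmetricAlgebra R M) : R →+* Away (symGrading R M) x :=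
  (fromZeroRingHom (symGrading R M) _).comp (algebraMap R (symGrading R M 0))

lemma val_awayBase (x : SymmetricAlgebra R M) (r : R) :
    (awayBase x r).val = algebraMap _ _ (algebraMap R (SymmetricAlgebra R M) r) := rfl

variable {κ : Type} (b : Module.Basis κ R M) (i : κ)

/-- The polynomial ring in the ratios `x_j / x_i`, mapping to the chart of `Proj (Sym M)` where
`x = x_i` does not vanish. -/
def polyToAway (x : SymmetricAlgebra R M) (hx : x = SymmetricAlgebra.ι R M (b i)) :
    MvPolynomial {j // j ≠ i} R →+* Away (symGrading R M) x :=
  MvPolynomial.eval₂Hom (awayBase x) fun j =>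
    Away.mk (symGrading R M) (hx ▸ ι_mem_symGrading (b i) : x ∈ symGrading R M 1) 1
      (SymmetricAlgebra.ι R M (b j)) (by simpa using ι_mem_symGrading (b j))

open Classical in
/-- Setting `x_i = 1`. -/
def dehomogenize : SymmetricAlgebra R M →ₐ[R] MvPolynomial {j // j ≠ i} R :=
  SymmetricAlgebra.lift (b.constr R fun j =>
    if h : j = i then (1 : MvPolynomial {j // j ≠ i} R) else MvPolynomial.X ⟨j, h⟩)

lemma dehomogenize_self : dehomogenize b i (SymmetricAlgebra.ι R M (b i)) = 1 := by
  simp [dehomogenize]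

lemma dehomogenize_ne (j : κ) (h : j ≠ i) :
    dehomogenize b i (SymmetricAlgebra.ι R M (b j)) = MvPolynomial.X ⟨j, h⟩ := by
  simp [dehomogenize, h]

/-- The inverse of `polyToAway`. -/
def awayToPoly : Away (symGrading R M) (SymmetricAlgebra.ι R M (b i)) →+*
    MvPolynomial {j // j ≠ i} R :=
  (IsLocalization.Away.lift (S := Localization.Away (SymmetricAlgebra.ι R M (b i)))
    (SymmetricAlgebra.ι R M (b i)) (g := (dehomogenize b i).toRingHom)
    (by
      change IsUnit (dehomogenize b i _)
      rw [dehomogenize_self]; exact isUnit_one)).comp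
    (algebraMap (Away (symGrading R M) (SymmetricAlgebra.ι R M (b i))) _)

lemma awayToPoly_mk (n : ℕ) (a : SymmetricAlgebra R M) (ha : a ∈ symGrading R M (n • 1)) :
    awayToPoly b i (Away.mk _ (ι_mem_symGrading (b i)) n a ha) = dehomogenize b i a := by
  rw [awayToPoly, RingHom.comp_apply, HomogeneousLocalization.algebraMap_apply, Away.val_mk,
    Localization.mk_eq_mk']
  erw [IsLocalization.lift_mk']
  rw [Units.mul_inv_eq_iff_eq_mul]
  erw [IsUnit.coe_liftRight]
  change dehomogenize b i a = dehomogenize b i a * dehomogenize b i (_ ^ n)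
  rw [map_pow, dehomogenize_self, one_pow, mul_one]

lemma awayToPoly_awayBase (r : R) :
    awayToPoly b i (awayBase _ r) = MvPolynomial.C r := by
  have : awayBase (SymmetricAlgebra.ι R M (b i)) r = Away.mk _ (ι_mem_symGrading (b i)) 0
      (algebraMap R _ r) (by simpa using SetLike.algebraMap_mem_graded _ r) := by
    apply val_injective
    rw [val_awayBase, Away.val_mk, ← Localization.mk_one_eq_algebraMap]
    congr 1
    ext; simp
  rw [this, awayToPoly_mk, AlgHom.commutes]
  rfl

lemma awayToPoly_polyToAway (p : MvPolynomial {j // j ≠ i} R) :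
    awayToPoly b i (polyToAway b i _ rfl p) = p := by
  have : (awayToPoly b i).comp (polyToAway b i _ rfl) = RingHom.id _ := by
    apply MvPolynomial.ringHom_ext
    · intro r; simp [polyToAway, awayToPoly_awayBase]
    · intro j
      simp [polyToAway, awayToPoly_mk, dehomogenize_ne b i j j.2]
  exact congr($this p)

lemma val_polyToAway_dehomogenize (n : ℕ) (a : SymmetricAlgebra R M) (ha : a ∈ symGrading R M n) :
    (polyToAway b i _ rfl (dehomogenize b i a)).val *
      algebraMap _ (Localization.Away (SymmetricAlgebra.ι R M (b i)))
        (SymmetricAlgebra.ι R M (b i)) ^ n = algebraMap _ _ a := by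
  induction ha using Submodule.pow_induction_on_left' with
  | algebraMap r =>
    rw [AlgHom.commutes, pow_zero, mul_one, MvPolynomial.algebraMap_eq, polyToAway,
      MvPolynomial.coe_eval₂Hom, MvPolynomial.eval₂_C, val_awayBase]
  | add x y n hx hy ihx ihy => rw [map_add, map_add, val_add, add_mul, ihx, ihy, map_add]
  | mem_mul m hm n x hx ih =>
    obtain ⟨m, rfl⟩ := hm
    rw [map_mul, map_mul, val_mul, pow_succ', mul_mul_mul_comm, ih, map_mul]
    congr 1
    clear ih hx x
    have hm : m ∈ Submodule.span R (Set.range b) := b.span_eq ▸ Submodule.mem_top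
    induction hm using Submodule.span_induction with
    | mem x hx =>
      obtain ⟨j, rfl⟩ := hx
      by_cases h : j = i
      · subst h
        rw [dehomogenize_self, map_one, val_one, one_mul]
      · rw [dehomogenize_ne b i j h, polyToAway, MvPolynomial.coe_eval₂Hom, MvPolynomial.eval₂_X,
          Away.val_mk, ← Localization.mk_one_eq_algebraMap, ← Localization.mk_one_eq_algebraMap,
          Localization.mk_mul, Localization.mk_eq_mk_iff, Localization.r_iff_exists]
        exact ⟨1, by simp [mul_comm]⟩
    | zero => simp
    | add x y _ _ hx hy => simp only [map_add, val_add, add_mul, hx, hy]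
    | smul r x _ hx =>
      simp only [map_smul, Algebra.smul_def, map_mul, val_mul, mul_assoc, hx]
      congr 1
      rw [AlgHom.commutes, MvPolynomial.algebraMap_eq, polyToAway,
        MvPolynomial.coe_eval₂Hom, MvPolynomial.eval₂_C, val_awayBase]

lemma polyToAway_bijective (x : SymmetricAlgebra R M) (hx : x = SymmetricAlgebra.ι R M (b i)) :
    Function.Bijective (polyToAway b i x hx) := by
  subst hx
  refine ⟨Function.LeftInverse.injective (awayToPoly_polyToAway b i), fun z => ?_⟩
  obtain ⟨n, a, ha, rfl⟩ := Away.mk_surjective _ (ι_mem_symGrading (b i)) z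
  refine ⟨dehomogenize b i a, val_injective _ ?_⟩
  have h := val_polyToAway_dehomogenize b i n a (by simpa using ha)
  rw [Away.val_mk, Localization.mk_eq_mk', eq_comm, IsLocalization.mk'_eq_iff_eq_mul, ← h]
  simp

variable (σ : R →+* S) (f : M →ₛₗ[σ] N) 

lemma awayMap_awayBase (x : SymmetricAlgebra R M) (r : R) :
    Away.map (symMap σ f) x (awayBase x r) = awayBase (symMap σ f x) (σ r) := by
  apply val_injective
  rw [val_awayBase, ← symMap_algebraMap σ f, ← Localization.mk_one_eq_algebraMap]
  change Localization.mk _ _ = _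
  congr 1
  ext; simp

/-- The chart of `Proj (Sym N)` is the base change of the chart of `Proj (Sym M)` if a basis of `M`
is mapped to a basis of `N`. -/
lemma isPushout_away (b' : Module.Basis κ S N) (hf : ∀ j, f (b j) = b' j) : IsPushout (CommRingCat.ofHom σ)
    (CommRingCat.ofHom (awayBase (SymmetricAlgebra.ι R M (b i))))
    (CommRingCat.ofHom (awayBase (symMap σ f (SymmetricAlgebra.ι R M (b i)))))
    (CommRingCat.ofHom (Away.map (symMap σ f) (SymmetricAlgebra.ι R M (b i)))) := by
  let _ : Algebra R S := σ.toAlgebra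
  let _ : Algebra (MvPolynomial {j // j ≠ i} R) (MvPolynomial {j // j ≠ i} S) :=
    MvPolynomial.algebraMvPolynomial
  refine (CommRingCat.isPushout_of_isPushout R S (MvPolynomial {j // j ≠ i} R)
    (MvPolynomial {j // j ≠ i} S)).of_iso (Iso.refl _) (Iso.refl _)
    (RingEquiv.ofBijective _ (polyToAway_bijective b i _ rfl)).toCommRingCatIso
    (RingEquiv.ofBijective _ (polyToAway_bijective b' i (symMap σ f (SymmetricAlgebra.ι R M (b i)))
      (by rw [symMap_ι, hf]))).toCommRingCatIso rfl ?_ ?_ ?_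
  · ext r
    simp [polyToAway]
  · ext r
    simp [polyToAway]
  · ext : 1
    apply MvPolynomial.ringHom_ext
    · intro r
      simp only [RingHom.coe_comp, CommRingCat.hom_comp, CommRingCat.hom_ofHom,
        RingEquiv.toCommRingCatIso_hom, Function.comp_apply, polyToAway, RingHom.coe_coe,
        RingEquiv.ofBijective_apply, MvPolynomial.coe_eval₂Hom, MvPolynomial.eval₂_C,
        awayMap_awayBase, MvPolynomial.algebraMap_def, MvPolynomial.map_C]
      rfl
    · intro r
      simp [polyToAway, hf]

end Chart

/-! ### Base change of `Proj (Sym M)` -/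

lemma isPullback_of_openCover {P X Y Z : Scheme.{u}} {fst : P ⟶ X} {snd : P ⟶ Y} {f : X ⟶ Z}
    {g : Y ⟶ Z} (w : fst ≫ f = snd ≫ g) (𝒰 : X.OpenCover) (W : 𝒰.I₀ → Scheme.{u})
    (a : ∀ i, W i ⟶ 𝒰.X i) (c : ∀ i, W i ⟶ P)
    (h₁ : ∀ i, IsPullback (a i) (c i) (𝒰.f i) fst)
    (h₂ : ∀ i, IsPullback (a i) (c i ≫ snd) (𝒰.f i ≫ f) g) : IsPullback fst snd f g := by
  obtain ⟨Q, p, q, hQ⟩ : ∃ (Q : Scheme.{u}) (p : Q ⟶ X) (q : Q ⟶ Y), IsPullback p q f g :=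
    ⟨_, _, _, IsPullback.of_hasPullback f g⟩
  obtain ⟨h, hp, hq⟩ : ∃ h : P ⟶ Q, h ≫ p = fst ∧ h ≫ q = snd :=
    ⟨hQ.lift fst snd w, hQ.lift_fst _ _ _, hQ.lift_snd _ _ _⟩
  have hiso : IsIso h := by
    change MorphismProperty.isomorphisms Scheme _
    rw [IsZariskiLocalAtTarget.iff_of_openCover (P := MorphismProperty.isomorphisms Scheme)
      (𝒰.pullback₁ p)]
    intro i
    have hQi : IsPullback (pullback.snd p (𝒰.f i)) (pullback.fst p (𝒰.f i)) (𝒰.f i) p :=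
      (IsPullback.of_hasPullback _ _).flip
    have hQi' := hQi.paste_vert hQ
    let k := (h₂ i).isoIsPullback _ _ hQi'
    have hk₁ : k.hom ≫ pullback.snd p (𝒰.f i) = a i := (h₂ i).isoIsPullback_hom_fst _ _ hQi'
    have hk₂ : k.hom ≫ pullback.fst p (𝒰.f i) = c i ≫ h := by
      apply hQ.hom_ext
      · rw [Category.assoc, ← hQi.w, reassoc_of% hk₁, Category.assoc, hp, (h₁ i).w]
      · rw [Category.assoc, Category.assoc, hq]
        exact (h₂ i).isoIsPullback_hom_snd _ _ hQi'
    have hk : IsPullback k.hom (c i) (pullback.fst p (𝒰.f i)) h :=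
      IsPullback.of_right (by rw [hk₁, hp]; exact h₁ i) hk₂ hQi
    have hP := (IsPullback.of_hasPullback h (pullback.fst p (𝒰.f i))).flip
    have : pullback.snd h (pullback.fst p (𝒰.f i)) = (hP.isoIsPullback _ _ hk).hom ≫ k.hom :=
      (hP.isoIsPullback_hom_fst _ _ hk).symm
    change IsIso (pullback.snd h (pullback.fst p (𝒰.f i)))
    rw [this]
    infer_instance
  exact hQ.of_iso (asIso h).symm (Iso.refl _) (Iso.refl _) (Iso.refl _)
    (by simp [← hp]) (by simp [← hq]) (by simp) (by simp)

section Proj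

open HomogeneousLocalization

variable {R S : Type u} [CommRing R] [CommRing S] {M N : Type u} [AddCommGroup M] [Module R M]
  [AddCommGroup N] [Module S N]

variable (R M) in
/-- The structure morphism `Proj (Sym_R M) ⟶ Spec R`. -/
def projToSpec : Proj (symGrading R M) ⟶ Spec (.of R) :=
  Proj.toSpecZero (symGrading R M) ≫
    Spec.map (CommRingCat.ofHom (algebraMap R (symGrading R M 0)))

lemma awayι_projToSpec {n : ℕ} (x : SymmetricAlgebra R M) (hx : x ∈ symGrading R M n)
    (hn : 0 < n) :
    Proj.awayι (symGrading R M) x hx hn ≫ projToSpec R M =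
      Spec.map (CommRingCat.ofHom (awayBase x)) := by
  rw [projToSpec, Proj.awayι_toSpecZero_assoc, ← Spec.map_comp]
  rfl

variable (σ : R →+* S) (f : M →ₛₗ[σ] N) (hf : Submodule.span S (Set.range f) = ⊤)

/-- The morphism `Proj (Sym_S N) ⟶ Proj (Sym_R M)` induced by a semilinear map `M → N` whose image
generates `N`. -/
def projMap : Proj (symGrading S N) ⟶ Proj (symGrading R M) :=
  Proj.map (symMap σ f) (irrelevant_le_map σ f hf)

lemma projMap_projToSpec :
    projMap σ f hf ≫ projToSpec R M = projToSpec S N ≫ Spec.map (CommRingCat.ofHom σ) := by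
  have key (n : ℕ) (hn : 0 < n) (x : SymmetricAlgebra R M) (hx : x ∈ symGrading R M n) :
      Proj.awayι (symGrading S N) (symMap σ f x) ((symMap σ f).map_mem hx) hn ≫
        projMap σ f hf ≫ projToSpec R M =
      Proj.awayι (symGrading S N) (symMap σ f x) ((symMap σ f).map_mem hx) hn ≫
        projToSpec S N ≫ Spec.map (CommRingCat.ofHom σ) := by
    rw [projMap, Proj.awayι_comp_map_assoc _ _ hn _ hx, awayι_projToSpec,
      ← Category.assoc, awayι_projToSpec, ← Spec.map_comp, ← Spec.map_comp]
    congr 1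
    ext r
    exact congrArg val (awayMap_awayBase σ f _ r)
  exact (Proj.mapAffineOpenCover _ (irrelevant_le_map σ f hf)).openCover.hom_ext _ _
    fun s => key s.1 s.1.2 s.2 s.2.2

lemma projMap_eq_id (σ : R →+* R) (f : M →ₛₗ[σ] M) (hf : Submodule.span R (Set.range f) = ⊤)
    (h₁ : ∀ r, σ r = r) (h₂ : ∀ m, f m = m) : projMap σ f hf = 𝟙 _ := by
  have key (φ : GradedRingHom (symGrading R M) (symGrading R M)) (hφ)
      (h : φ = GradedRingHom.id _) : Proj.map φ hφ = 𝟙 _ := by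
    subst h; exact Proj.map_id
  apply key
  refine GradedRingHom.ext fun x => ?_
  have : symMapRingHom σ f = RingHom.id _ := sym_ringHom_ext (by simp [h₁]) (by simp [h₂])
  exact congr($this x)

lemma projMap_comp {T : Type u} [CommRing T] {L : Type u} [AddCommGroup L] [Module T L]
    (τ : S →+* T) (g : N →ₛₗ[τ] L) (hg : Submodule.span T (Set.range g) = ⊤)
    (ρ : R →+* T) (k : M →ₛₗ[ρ] L) (hk : Submodule.span T (Set.range k) = ⊤)
    (h₁ : ∀ r, ρ r = τ (σ r)) (h₂ : ∀ m, k m = g (f m)) :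
    projMap ρ k hk = projMap τ g hg ≫ projMap σ f hf := by
  have key (φ : GradedRingHom (symGrading R M) (symGrading T L)) (hφ)
      (h : φ = (symMap τ g).comp (symMap σ f)) :
      Proj.map φ hφ = projMap τ g hg ≫ projMap σ f hf := by
    subst h; exact Proj.map_comp _ _ _ _
  apply key
  refine GradedRingHom.ext fun x => ?_
  have : symMapRingHom ρ k = (symMapRingHom τ g).comp (symMapRingHom σ f) :=
    sym_ringHom_ext (by simp [h₁]) (by simp [h₂])
  exact congr($this x)

lemma isPullback_projMap {κ : Type} (b : Module.Basis κ R M) (b' : Module.Basis κ S N)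
    (hb : ∀ j, f (b j) = b' j) :
    IsPullback (projMap σ f hf) (projToSpec S N) (projToSpec R M)
      (Spec.map (CommRingCat.ofHom σ)) := by
  let 𝒰 := Proj.affineOpenCoverOfIrrelevantLESpan (symGrading R M)
    (fun i => SymmetricAlgebra.ι R M (b i)) (m := fun _ => 1)
    (fun i => ι_mem_symGrading (b i)) (fun _ => one_pos) (irrelevant_le_span b b.span_eq)
  refine isPullback_of_openCover (projMap_projToSpec σ f hf) 𝒰.openCover
    (fun i => Spec (.of (Away (symGrading S N) (symMap σ f (SymmetricAlgebra.ι R M (b i))))))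
    (fun i => Spec.map (CommRingCat.ofHom (Away.map (symMap σ f) (SymmetricAlgebra.ι R M (b i)))))
    (fun i => Proj.awayι _ _ ((symMap σ f).map_mem (ι_mem_symGrading (b i))) one_pos) ?_ ?_
  · intro i
    refine IsOpenImmersion.isPullback _ _ _ _
      (Proj.awayι_comp_map (symMap σ f) _ one_pos _ (ι_mem_symGrading (b i))) ?_
    change _ ⁻¹ᵁ (Proj.awayι _ _ _ _).opensRange = _
    rw [Proj.opensRange_awayι, Proj.opensRange_awayι]
    rfl
  · intro i
    change IsPullback _ _ (Proj.awayι _ _ _ _ ≫ _) _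
    rw [awayι_projToSpec, awayι_projToSpec]
    exact (isPullback_SpecMap_of_isPushout _ _ _ _ (isPushout_away b i σ f b' hb)).flip

end Proj

/-! ### Vector bundles and projective bundles -/

section Bundle

variable {X : Scheme.{u}} (E : X.Modules)

/-- The restriction map `E(U) → E(V)` for `V ⊆ U`, semilinear over `𝒪(U) → 𝒪(V)`. -/
def res {U V : X.Opens} (h : V ≤ U) :
    Γ(E, U) →ₛₗ[(X.presheaf.map (homOfLE h).op).hom] Γ(E, V) where
  toFun := E.presheaf.map (homOfLE h).op
  map_add' x y := map_add _ x y
  map_smul' r x := Scheme.Modules.map_smul E (homOfLE h) r x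

lemma res_refl (U : X.Opens) (x : Γ(E, U)) : res E (le_refl U) x = x :=
  congr($(E.presheaf.map_id (Opposite.op U)) x)

lemma res_res {U V W : X.Opens} (h : V ≤ U) (h' : W ≤ V) (x : Γ(E, U)) :
    res E h' (res E h x) = res E (h'.trans h) x :=
  congr($(E.presheaf.map_comp (homOfLE h).op (homOfLE h').op) x).symm

/-- Sections `s₁, …, s_r` of `E` over `U` form a frame if they induce an isomorphism
`𝒪_U^r ≅ E|_U`, i.e. an isomorphism `𝒪(V)^r ≅ E(V)` for each open `V ⊆ U`. -/
def IsFrame {r : ℕ} {U : X.Opens} (s : Fin r → Γ(E, U)) : Prop :=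
  ∀ (V : X.Opens) (h : V ≤ U),
    Function.Bijective fun a : Fin r → Γ(X, V) => ∑ i, a i • res E h (s i)

/-- `E` is a vector bundle (locally free sheaf) of rank `r`: it has a frame of `r` sections in a
neighbourhood of each point. -/
class IsVectorBundle (r : ℕ) : Prop where
  exists_frame : ∀ x : X, ∃ U : X.Opens, x ∈ U ∧ ∃ s : Fin r → Γ(E, U), IsFrame E s

variable {E} in
lemma IsFrame.restrict {r : ℕ} {U V : X.Opens} {s : Fin r → Γ(E, U)} (hs : IsFrame E s)
    (h : V ≤ U) : IsFrame E fun i => res E h (s i) := by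
  intro W hW
  simp only [res_res]
  exact hs W (hW.trans h)

variable {E} in
/-- The basis of `E(V)` given by a frame over `U ⊇ V`. -/
def IsFrame.basis {r : ℕ} {U V : X.Opens} {s : Fin r → Γ(E, U)} (hs : IsFrame E s)
    (h : V ≤ U) : Module.Basis (Fin r) Γ(X, V) Γ(E, V) :=
  .ofEquivFun (LinearEquiv.ofBijective
    (Fintype.linearCombination Γ(X, V) fun i => res E h (s i)) (hs V h)).symm

variable {E} in
lemma IsFrame.basis_apply {r : ℕ} {U V : X.Opens} {s : Fin r → Γ(E, U)} (hs : IsFrame E s)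
    (h : V ≤ U) (i : Fin r) : hs.basis h i = res E h (s i) := by
  simp only [IsFrame.basis, Module.Basis.coe_ofEquivFun, LinearEquiv.symm_symm]
  change Fintype.linearCombination Γ(X, V) (fun i => res E h (s i)) (Pi.single i 1) = _
  rw [Fintype.linearCombination_apply_single, one_smul]

variable (r : ℕ)

/-- The affine opens of `X` over which `E` has a frame of `r` sections. -/
structure FrameOpens where
  /-- The underlying open subset. -/
  opens : X.Opens
  isAffine : IsAffineOpen opens
  exists_frame : ∃ s : Fin r → Γ(E, opens), IsFrame E s

instance : Preorder (FrameOpens E r) := Preorder.lift FrameOpens.opens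

lemma isBasis_frameOpens [IsVectorBundle E r] :
    Opens.IsBasis (Set.range (FrameOpens.opens : FrameOpens E r → X.Opens)) := by
  rw [Opens.isBasis_iff_nbhd]
  intro U x hx
  obtain ⟨V, hxV, s, hs⟩ := IsVectorBundle.exists_frame (E := E) (r := r) x
  obtain ⟨W, hW, hxW, hWUV⟩ := Opens.isBasis_iff_nbhd.mp X.isBasis_affineOpens
    (show x ∈ U ⊓ V from ⟨hx, hxV⟩)
  exact ⟨W, ⟨⟨W, hW, _, hs.restrict (hWUV.trans inf_le_right)⟩, rfl⟩, hxW,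
    hWUV.trans inf_le_left⟩

variable {E r} in
lemma span_range_res {U V : FrameOpens E r} (h : U ≤ V) :
    Submodule.span Γ(X, U.opens) (Set.range (res E (U := V.opens) (V := U.opens) h)) = ⊤ := by
  obtain ⟨s, hs⟩ := V.exists_frame
  rw [eq_top_iff, ← (hs.basis (V := U.opens) h).span_eq]
  refine Submodule.span_mono ?_
  rintro _ ⟨i, rfl⟩
  exact ⟨s i, (hs.basis_apply h i).symm⟩

variable {E r} in
lemma isoSpec_inv_homOfLE {U V : FrameOpens E r} (h : U ≤ V) :
    Spec.map (X.presheaf.map (homOfLE h : U.opens ⟶ V.opens).op) ≫ V.isAffine.isoSpec.inv =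
      U.isAffine.isoSpec.inv ≫ X.homOfLE (U := U.opens) (V := V.opens) h := by
  rw [Iso.comp_inv_eq, Category.assoc, Iso.eq_inv_comp]
  exact Scheme.Opens.toSpecΓ_SpecMap_presheaf_map U.opens V.opens h

lemma localProjToBase_aux {U V : FrameOpens E r} (h : U ≤ V) :
    projMap _ (res E (U := V.opens) (V := U.opens) h) (span_range_res h) ≫
      projToSpec Γ(X, V.opens) Γ(E, V.opens) ≫ V.isAffine.isoSpec.inv =
    (projToSpec Γ(X, U.opens) Γ(E, U.opens) ≫ U.isAffine.isoSpec.inv) ≫ X.homOfLE (U := U.opens) (V := V.opens) h := by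
  rw [← Category.assoc, projMap_projToSpec, Category.assoc, Category.assoc]
  congr 1
  exact isoSpec_inv_homOfLE h

lemma isPullback_localProj {U V : FrameOpens E r} (h : U ≤ V) :
    IsPullback (projMap _ (res E (U := V.opens) (V := U.opens) h) (span_range_res h))
      (projToSpec Γ(X, U.opens) Γ(E, U.opens) ≫ U.isAffine.isoSpec.inv)
      (projToSpec Γ(X, V.opens) Γ(E, V.opens) ≫ V.isAffine.isoSpec.inv)
      (X.homOfLE (U := U.opens) (V := V.opens) h) := by
  obtain ⟨s, hs⟩ := V.exists_frame
  have h₁ := isPullback_projMap _ (res E (U := V.opens) (V := U.opens) h)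
    (span_range_res h) (hs.basis (V := V.opens) le_rfl) (hs.basis (V := U.opens) h)
    (fun j => by rw [hs.basis_apply, hs.basis_apply, res_res])
  have h₂ : IsPullback (Spec.map (X.presheaf.map (homOfLE h : U.opens ⟶ V.opens).op))
      U.isAffine.isoSpec.inv V.isAffine.isoSpec.inv
      (X.homOfLE (U := U.opens) (V := V.opens) h) :=
    IsPullback.of_vert_isIso ⟨isoSpec_inv_homOfLE h⟩
  exact h₁.paste_vert h₂

variable [IsVectorBundle E r]

/-- The open cover of `X` by all affine opens over which `E` has a frame. -/
def frameCover : X.OpenCover where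
  I₀ := FrameOpens E r
  X U := U.opens
  f U := U.opens.ι
  mem₀ := by
    rw [Scheme.presieve₀_mem_precoverage_iff]
    refine ⟨fun x ↦ ?_, inferInstance⟩
    obtain ⟨_, ⟨U, rfl⟩, hxU, -⟩ := Opens.isBasis_iff_nbhd.mp (isBasis_frameOpens E r)
      (Opens.mem_top x)
    exact ⟨U, by simpa using hxU⟩

instance : Preorder (frameCover E r).I₀ := inferInstanceAs (Preorder (FrameOpens E r))

instance : Scheme.Cover.LocallyDirected (frameCover E r) :=
  .ofIsBasisOpensRange
    (fun {i j} => by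
      change i ≤ j ↔ (FrameOpens.opens i).ι.opensRange ≤ (FrameOpens.opens j).ι.opensRange
      rw [Scheme.Opens.opensRange_ι, Scheme.Opens.opensRange_ι]
      rfl)
    (by
      change Opens.IsBasis (Set.range fun i => (FrameOpens.opens i).ι.opensRange)
      simp only [Scheme.Opens.opensRange_ι]
      exact isBasis_frameOpens E r)

lemma frameCover_trans {U V : FrameOpens E r} (h : U ≤ V) :
    (frameCover E r).trans (i := U) (j := V) (homOfLE h) = X.homOfLE (U := U.opens) (V := V.opens) h := rfl

/-- The functor `U ↦ Proj (Sym E(U))` on the affine opens over which `E` has a frame. -/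
def localProj : FrameOpens E r ⥤ Scheme.{u} where
  obj U := Proj (symGrading Γ(X, U.opens) Γ(E, U.opens))
  map {U V} h := projMap _ (res E (U := V.opens) (V := U.opens) (leOfHom h))
    (span_range_res (leOfHom h))
  map_id U := projMap_eq_id _ _ _ (fun x => congr($(X.presheaf.map_id (Opposite.op U.opens)) x))
    (res_refl E _)
  map_comp {U V W} h h' := projMap_comp _ _ _ _ _ _ _ _ _
    (fun x => congr($(X.presheaf.map_comp (homOfLE (leOfHom h') : V.opens ⟶ W.opens).op
      (homOfLE (leOfHom h) : U.opens ⟶ V.opens).op) x))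
    (fun m => (res_res E (U := W.opens) (V := V.opens) (W := U.opens) _ _ m).symm)

/-- The structure morphisms `Proj (Sym E(U)) ⟶ Spec 𝒪(U) ≅ U`. -/
def localProjToBase : localProj E r ⟶ (frameCover E r).functorOfLocallyDirected where
  app U := projToSpec Γ(X, U.opens) Γ(E, U.opens) ≫ U.isAffine.isoSpec.inv
  naturality _ _ h := localProjToBase_aux E r (leOfHom h)

/-- The gluing data for `ℙ(E)`. -/
def projGluingData : (frameCover E r).RelativeGluingData where
  functor := localProj E r
  natTrans := localProjToBase E r
  equifibered U V h := isPullback_localProj E r (U := U) (V := V) (leOfHom h)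

instance : Small.{u} (frameCover E r).I₀ := inferInstanceAs (Small.{u} (FrameOpens E r))

instance : Quiver.IsThin (frameCover E r).I₀ := inferInstanceAs (Quiver.IsThin (FrameOpens E r))

/-- The projective bundle `ℙ(E) = Proj (Sym E)` of a vector bundle `E` of rank `r` on `X`, glued
from the schemes `Proj (Sym E(U))`. -/
def ProjBundle : Scheme.{u} := (projGluingData E r).glued

/-- The projection `ℙ(E) ⟶ X`. -/
def ProjBundle.toBase : ProjBundle E r ⟶ X := (projGluingData E r).toBase

end Bundle

/-! ### Differentials -/

section Diff

variable {k : Type u} [Field k]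

/-- For a `k`-scheme `X`, the morphism `k → 𝒪_X` from the constant presheaf. -/
def constToPresheaf {X : Scheme.{u}} (x : X ⟶ Spec (.of k)) :
    (Functor.const X.Opensᵒᵖ).obj (CommRingCat.of k) ⟶ X.presheaf where
  app U := (Scheme.ΓSpecIso (.of k)).inv ≫ x.appTop ≫ X.presheaf.map (homOfLE le_top).op
  naturality U V i := by
    simp only [Functor.const_obj_obj, Functor.const_obj_map, Category.id_comp, Category.assoc,
      ← Functor.map_comp]
    rfl

/-- The presheaf `U ↦ Ω_{𝒪(U)/k}`. -/
def presheafOmega {X : Scheme.{u}} (x : X ⟶ Spec (.of k)) : X.PresheafOfModules :=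
  PresheafOfModules.DifferentialsConstruction.relativeDifferentials' (constToPresheaf x)

/-- The cotangent sheaf `Ω¹_X = Ω¹_{X/k}` of a `k`-scheme `X`: the sheaf associated to
`U ↦ Ω_{𝒪(U)/k}`. -/
def Omega {X : Scheme.{u}} (x : X ⟶ Spec (.of k)) : X.Modules :=
  (PresheafOfModules.sheafification (𝟙 X.ringCatSheaf.obj)).obj (presheafOmega x)

/-- The canonical map from the presheaf `U ↦ Ω_{𝒪(U)/k}` to the associated sheaf. -/
def toOmega {X : Scheme.{u}} (x : X ⟶ Spec (.of k)) :
    presheafOmega x ⟶ (Scheme.Modules.toPresheafOfModules X).obj (Omega x) :=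
  (PresheafOfModules.sheafificationAdjunction (𝟙 X.ringCatSheaf.obj)).unit.app (presheafOmega x)

/-- The universal derivation `d : 𝒪_X → Ω¹_X`. -/
def omegaD {X : Scheme.{u}} (x : X ⟶ Spec (.of k)) :
    ((Scheme.Modules.toPresheafOfModules X).obj (Omega x)).Derivation' (constToPresheaf x) :=
  (PresheafOfModules.DifferentialsConstruction.derivation' (constToPresheaf x)).postcomp (toOmega x)

/-- The universal derivation on sections over `U`. -/
def omegaDOn {X : Scheme.{u}} (x : X ⟶ Spec (.of k)) (U : X.Opens) : Γ(X, U) →+ Γ(Omega x, U) :=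
  (omegaD x).d (X := Opposite.op U)

lemma omegaDOn_mul {X : Scheme.{u}} (x : X ⟶ Spec (.of k)) (U : X.Opens) (a b : Γ(X, U)) :
    omegaDOn x U (a * b) = a • omegaDOn x U b + b • omegaDOn x U a :=
  (omegaD x).d_mul a b

lemma omegaDOn_map {X : Scheme.{u}} (x : X ⟶ Spec (.of k)) {U V : X.Opens} (i : V ⟶ U)
    (a : Γ(X, U)) :
    omegaDOn x V (X.presheaf.map i.op a) = (Omega x).presheaf.map i.op (omegaDOn x U a) :=
  (omegaD x).d_map i.op a

lemma omegaDOn_const {X : Scheme.{u}} (x : X ⟶ Spec (.of k)) (U : X.Opens) (a : k) :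
    omegaDOn x U ((constToPresheaf x).app (Opposite.op U) a) = 0 :=
  (omegaD x).d_app (X := Opposite.op U) a

variable {X C : Scheme.{u}} (π : X ⟶ C) (c : C ⟶ Spec (.of k))

lemma constToPresheaf_app (U : C.Opens) :
    (constToPresheaf c).app (Opposite.op U) ≫ π.app U =
      (constToPresheaf (π ≫ c)).app (Opposite.op (π ⁻¹ᵁ U)) := by
  simp only [constToPresheaf, Category.assoc, Scheme.Hom.comp_appTop]
  rw [π.naturality]
  rfl

/-- For `π : X ⟶ C`, the derivation `𝒪_C → π_* 𝒪_X → π_* Ω¹_X`. -/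
def pushforwardD : ((Scheme.Modules.toPresheafOfModules C).obj
      ((Scheme.Modules.pushforward π).obj (Omega (π ≫ c)))).Derivation' (constToPresheaf c) where
  d {U} := (omegaDOn (π ≫ c) (π ⁻¹ᵁ U.unop)).comp (π.app U.unop).hom.toAddMonoidHom
  d_mul {U} a b := by
    refine Eq.trans (congrArg (omegaDOn (π ≫ c) (π ⁻¹ᵁ U.unop))
      (map_mul (π.app U.unop).hom a b)) ?_
    exact omegaDOn_mul (π ≫ c) (π ⁻¹ᵁ U.unop) _ _
  d_map {U V} i f := by
    refine Eq.trans (congrArg (omegaDOn (π ≫ c) (π ⁻¹ᵁ V.unop)) congr($(π.naturality i) f)) ?_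
    exact omegaDOn_map (π ≫ c) ((Opens.map π.base).map i.unop) _
  d_app {U} a := by
    refine Eq.trans (congrArg (omegaDOn (π ≫ c) (π ⁻¹ᵁ U.unop))
      congr($(constToPresheaf_app π c U.unop) a)) ?_
    exact omegaDOn_const (π ≫ c) (π ⁻¹ᵁ U.unop) a

/-- The natural map `η : Ω¹_C ⟶ π_* Ω¹_X` of `𝒪_C`-modules: the one with `η (df) = d (f ∘ π)`. -/
def eta : Omega c ⟶ (Scheme.Modules.pushforward π).obj (Omega (π ≫ c)) :=
  ((PresheafOfModules.sheafificationAdjunction (𝟙 C.ringCatSheaf.obj)).homEquiv _ _).symm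
    ((PresheafOfModules.DifferentialsConstruction.isUniversal' (constToPresheaf c)).desc
      (pushforwardD π c))

/-- The map `η` is characterized by `η (df) = d (f ∘ π)`. -/
lemma eta_omegaDOn (U : C.Opens) (f : Γ(C, U)) :
    (eta π c).app U (omegaDOn c U f) = omegaDOn (π ≫ c) (π ⁻¹ᵁ U) (π.app U f) := by
  have h₁ := ((PresheafOfModules.sheafificationAdjunction (𝟙 C.ringCatSheaf.obj)).homEquiv
    (presheafOmega c) ((Scheme.Modules.pushforward π).obj (Omega (π ≫ c)))).apply_symm_apply
    ((PresheafOfModules.DifferentialsConstruction.isUniversal' (constToPresheaf c)).desc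
      (pushforwardD π c))
  have h₂ := (PresheafOfModules.DifferentialsConstruction.isUniversal' (constToPresheaf c)).fac
    (pushforwardD π c)
  have h₃ := PresheafOfModules.Derivation.congr_d h₂ (X := Opposite.op U) f
  refine Eq.trans ?_ h₃
  have h₄ : toOmega c ≫ (Scheme.Modules.toPresheafOfModules C).map (eta π c) =
      (PresheafOfModules.DifferentialsConstruction.isUniversal' (constToPresheaf c)).desc
        (pushforwardD π c) := h₁
  exact congrArg (fun g => ((PresheafOfModules.DifferentialsConstruction.derivation'
    (constToPresheaf c)).postcomp g).d (X := Opposite.op U) f) h₄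

end Diff

section Curve

attribute [local instance] MvPolynomial.gradedAlgebra

variable {k : Type u} [Field k]

/-- Projective `n`-space `ℙⁿ_k = Proj k[x₀, …, x_n]`. -/
def ProjSpace (k : Type u) [Field k] (n : ℕ) : Scheme.{u} :=
  Proj (MvPolynomial.homogeneousSubmodule (Fin (n + 1)) k)

/-- The structure morphism `ℙⁿ_k ⟶ Spec k`. -/
def ProjSpace.toSpec (k : Type u) [Field k] (n : ℕ) : ProjSpace k n ⟶ Spec (.of k) :=
  Proj.toSpecZero (MvPolynomial.homogeneousSubmodule (Fin (n + 1)) k) ≫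
    Spec.map (CommRingCat.ofHom
      (algebraMap k (MvPolynomial.homogeneousSubmodule (Fin (n + 1)) k 0)))

/-- `c : C ⟶ Spec k` is a smooth irreducible projective curve over `k`. -/
structure IsSmoothProjectiveCurve {C : Scheme.{u}} (c : C ⟶ Spec (.of k)) : Prop where
  irreducible : IrreducibleSpace C
  smooth : SmoothOfRelativeDimension 1 c
  projective : ∃ (n : ℕ) (i : C ⟶ ProjSpace k n),
    IsClosedImmersion i ∧ i ≫ ProjSpace.toSpec k n = c

/-- `π : X ⟶ C` is the ruled surface `ℙ_C(E) ⟶ C` of the rank two vector bundle `E` on `C`, i.e.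
`X` is isomorphic to `ℙ_C(E)` over `C`. -/
def IsRuledSurface {X C : Scheme.{u}} (π : X ⟶ C) (E : C.Modules) [IsVectorBundle E 2] : Prop :=
  ∃ e : X ≅ ProjBundle E 2, e.hom ≫ ProjBundle.toBase E 2 = π

end Curve

end

end RuledSurface

/-! Morally, this is the sequence `0 → π^*Ω_C → Ω_X → Ω_{X/C} → 0` pushed forward to `C`: fibrewise
`Ω_{X/C}` is `𝒪(-2)`, which has no sections, and `π_*𝒪_X = 𝒪_C`. The proof carries this out by
explicit Čech calculations with the two standard charts of a projective line.

Both sides are sheaves, so bijectivity on a basis of opens suffices (`isIso_eta_of_basis`). Take `U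
= Spec A` affine with a frame of `E`. Then `π⁻¹(U)` is glued from `Spec A[t]` and `Spec A[s]` along
`s = t⁻¹`. Sections of the cotangent sheaf over an affine open are Kähler differentials of its ring
(`kahToOmega_bijective`), so the claim becomes algebraic: `Ω_A` maps bijectively onto the pairs of
differentials on the two charts that agree in `Ω_L`, where `L = A[t, t⁻¹]`.

Injectivity holds already on one chart, by taking constant coefficients
(`map_injective_of_polynomial`). For surjectivity (`exists_map_eq`), the images of a pair in
relative differentials satisfy `p(t) dt = -q(t⁻¹) t⁻² dt`; comparing degrees kills both
(`relative_eq_zero`). Hence the pair comes from `A[t] ⊗ Ω_A` and `A[s] ⊗ Ω_A`. Formal smoothness of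
`L` over `A` makes `L ⊗ Ω_A → Ω_L` injective, so the two tensors agree in `L ⊗ Ω_A`. Truncating by
degree then shows that both are constant, that is, come from `Ω_A`. -/

namespace RuledSurface

noncomputable section

/-! ### Differentials of polynomial and Laurent polynomial rings -/

section LaurentAlgebra

open Polynomial LaurentPolynomial TensorProduct

variable (A : Type*) [CommRing A]

/-- The derivative of Laurent polynomials as a linear map. -/
def laurentDerivativeLinear : A[T;T⁻¹] →ₗ[A] A[T;T⁻¹] :=
  (Finsupp.lsum A fun n : ℤ =>
      LinearMap.toSpanSingleton A A[T;T⁻¹] ((n : A[T;T⁻¹]) * T (n - 1))) ∘ₗ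
    (AddMonoidAlgebra.coeffLinearEquiv A).toLinearMap

lemma laurentDerivativeLinear_C_mul_T (n : ℤ) (a : A) :
    laurentDerivativeLinear A (LaurentPolynomial.C a * T n) =
      LaurentPolynomial.C a * ((n : A[T;T⁻¹]) * T (n - 1)) := by
  rw [← single_eq_C_mul_T, ← LaurentPolynomial.smul_eq_C_mul, laurentDerivativeLinear,
    LinearMap.comp_apply]
  change Finsupp.lsum A _ (Finsupp.single n a) = _
  rw [Finsupp.lsum_single, LinearMap.toSpanSingleton_apply]

/-- The derivative of Laurent polynomials. -/
def laurentDerivative : Derivation A A[T;T⁻¹] A[T;T⁻¹] :=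
  Derivation.mk' (laurentDerivativeLinear A) fun p q => by
    induction p using LaurentPolynomial.induction_on' with
    | add p p' hp hp' => simp only [add_mul, map_add, hp, hp', smul_eq_mul]; ring
    | C_mul_T n a =>
      induction q using LaurentPolynomial.induction_on' with
      | add q q' hq hq' => simp only [mul_add, map_add, hq, hq', smul_eq_mul]; ring
      | C_mul_T m b =>
        have h : LaurentPolynomial.C a * T n * (LaurentPolynomial.C b * T m) =
            LaurentPolynomial.C (a * b) * T (n + m) := by
          rw [map_mul, T_add]; ring
        rw [h]
        simp only [laurentDerivativeLinear_C_mul_T, smul_eq_mul]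
        rw [map_mul]
        rw [show n + m - 1 = n + (m - 1) by ring, T_add n (m - 1)]
        -- Both Leibniz terms carry the same monomial, of exponent `n + m - 1`; only the
        -- coefficients `n` and `m` remain to be added.
        have h' : (T n * T (m - 1) : A[T;T⁻¹]) = T m * T (n - 1) := by
          rw [← T_add, ← T_add]; congr 1; ring
        push_cast
        linear_combination (LaurentPolynomial.C a * LaurentPolynomial.C b * n) * h'

lemma laurentDerivative_T (n : ℤ) : laurentDerivative A (T n) = (n : A[T;T⁻¹]) * T (n - 1) := by
  have := laurentDerivativeLinear_C_mul_T A n 1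
  rwa [map_one, one_mul, one_mul] at this

/-- The truncation of Laurent polynomials to their terms of nonnegative degree, as a linear map. -/
def truncLinear : A[T;T⁻¹] →ₗ[A] A[X] where
  toFun := trunc
  map_add' := map_add _
  map_smul' r p := by
    induction p using LaurentPolynomial.induction_on' with
    | add p q hp hq => rw [smul_add, map_add, hp, hq, map_add, smul_add]
    | C_mul_T n a =>
      rw [LaurentPolynomial.smul_eq_C_mul, ← mul_assoc, ← map_mul, trunc_C_mul_T, trunc_C_mul_T]
      split_ifs <;> simp [smul_monomial]

variable {A}

/-- A polynomial in `T⁻¹` meets the nonnegative degrees only in degree `0`. This is the form in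
which `A[T] ∩ A[T⁻¹] = A` is used. -/
lemma trunc_invert_toLaurent (p : A[X]) :
    trunc (invert (toLaurent p)) = Polynomial.C (p.coeff 0) := by
  induction p using Polynomial.induction_on' with
  | add p q hp hq => simp only [map_add, hp, hq, coeff_add]
  | monomial n a =>
    rw [← C_mul_X_pow_eq_monomial, toLaurent_C_mul_X_pow, map_mul, invert_C, invert_T,
      trunc_C_mul_T]
    rcases n with _ | n
    · simp
    · rw [if_neg (by push_cast; lia)]; simp

lemma trunc_invert_toLaurent_mul_T (p : A[X]) {m : ℤ} (hm : m < 0) :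
    trunc (invert (toLaurent p) * T m) = 0 := by
  induction p using Polynomial.induction_on' with
  | add p q hp hq => simp only [map_add, add_mul, hp, hq, add_zero]
  | monomial n a =>
    rw [← C_mul_X_pow_eq_monomial, toLaurent_C_mul_X_pow, map_mul invert, invert_C, invert_T,
      mul_assoc, ← T_add, trunc_C_mul_T, if_neg (by lia)]

end LaurentAlgebra

/-! ### Kähler differentials on the projective line over a ring, chart by chart. -/

section Kaehler

open TensorProduct KaehlerDifferential

/-- The kernel is the image of `H1Cotangent A B`, which vanishes for a formally smooth algebra. -/
lemma mapBaseChange_injective_of_formallySmooth (k A B : Type*) [CommRing k] [CommRing A]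
    [CommRing B] [Algebra k A] [Algebra k B] [Algebra A B] [IsScalarTower k A B]
    [Algebra.FormallySmooth A B] : Function.Injective (mapBaseChange k A B) := by
  rw [injective_iff_map_eq_zero]
  intro x hx
  obtain ⟨x, rfl⟩ := (Algebra.H1Cotangent.exact_δ_mapBaseChange k A B x).mp hx
  rw [Subsingleton.elim x 0, map_zero]

open Polynomial LaurentPolynomial

/-- The chain rule `d(p(X)) = p'(X) dX` shows that `dX` generates the relative differentials. -/
lemma exists_smul_D_of_polynomial {A B : Type*} [CommRing A] [CommRing B] [Algebra A B]
    (e : A[X] ≃ₐ[A] B) (z : Ω[B⁄A]) : ∃ p : A[X], z = e p • D A B (e X) := by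
  have hz : z ∈ Submodule.span B (Set.range (D A B)) := by
    rw [span_range_derivation]; trivial
  induction hz using Submodule.span_induction with
  | mem z hz =>
    obtain ⟨b, rfl⟩ := hz
    obtain ⟨p, rfl⟩ := e.surjective b
    have he : ∀ q, e q = aeval (e X) q := fun q =>
      congr($(Polynomial.algHom_ext (f := e.toAlgHom) (g := aeval (e X)) (by simp)) q)
    refine ⟨derivative p, ?_⟩
    rw [he p, Derivation.map_aeval, ← he]
  | zero => exact ⟨0, by simp⟩
  | add x y _ _ hx hy =>
    obtain ⟨p, rfl⟩ := hx
    obtain ⟨q, rfl⟩ := hy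
    exact ⟨p + q, by rw [map_add, add_smul]⟩
  | smul b x _ hx =>
    obtain ⟨p, rfl⟩ := hx
    obtain ⟨q, rfl⟩ := e.surjective b
    exact ⟨q * p, by rw [map_mul, mul_smul]⟩

variable (k : Type*) {A B₀ B₁ L : Type*} [CommRing k] [CommRing A] [CommRing B₀] [CommRing B₁]
  [CommRing L] [Algebra k A] [Algebra k B₀] [Algebra k B₁] [Algebra k L] [Algebra A B₀]
  [Algebra A B₁] [Algebra A L] [Algebra B₀ L] [Algebra B₁ L] [IsScalarTower k A B₀]
  [IsScalarTower k A B₁] [IsScalarTower k A L] [IsScalarTower k B₀ L] [IsScalarTower k B₁ L]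
  [IsScalarTower A B₀ L] [IsScalarTower A B₁ L]

/-- The functional on `Ω[L⁄A]` with `d T ↦ 1`, for a ring `L` of Laurent polynomials. -/
def laurentFunctional (e : A[T;T⁻¹] ≃ₐ[A] L) : Ω[L⁄A] →ₗ[L] L :=
  Derivation.liftKaehlerDifferential <|
    Derivation.mk' (e.toLinearMap ∘ₗ (laurentDerivative A).toLinearMap ∘ₗ e.symm.toLinearMap)
      fun a b => by
        obtain ⟨a, rfl⟩ := e.surjective a
        obtain ⟨b, rfl⟩ := e.surjective b
        simp only [LinearMap.comp_apply, AlgEquiv.toLinearMap_apply, Derivation.coeFn_coe,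
          AlgEquiv.symm_apply_apply, ← map_mul, Derivation.leibniz, map_add, smul_eq_mul]

lemma laurentFunctional_D (e : A[T;T⁻¹] ≃ₐ[A] L) (p : A[T;T⁻¹]) :
    laurentFunctional e (D A L (e p)) = e (laurentDerivative A p) := by
  simp [laurentFunctional]

/-- There are no nonzero global relative differentials on the projective line over `A`. -/
lemma relative_eq_zero (e₀ : A[X] ≃ₐ[A] B₀) (e₁ : A[X] ≃ₐ[A] B₁) (e : A[T;T⁻¹] ≃ₐ[A] L)
    (h₀ : ∀ p, algebraMap B₀ L (e₀ p) = e (toLaurent p))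
    (h₁ : ∀ p, algebraMap B₁ L (e₁ p) = e (invert (toLaurent p)))
    (x : Ω[B₀⁄A]) (y : Ω[B₁⁄A])
    (hxy : map A A B₀ L x = map A A B₁ L y) : x = 0 ∧ y = 0 := by
  obtain ⟨p, rfl⟩ := exists_smul_D_of_polynomial e₀ x
  obtain ⟨q, rfl⟩ := exists_smul_D_of_polynomial e₁ y
  -- Sending `dT` to `1` turns the equality of forms into one of Laurent polynomials.
  have h := congr(laurentFunctional e $hxy)
  rw [(map A A B₀ L).map_smul, (map A A B₁ L).map_smul, map_D, map_D,
    ← algebraMap_smul L, ← algebraMap_smul L (e₁ q), map_smul, map_smul, h₀, h₀, h₁, h₁, laurentFunctional_D, laurentFunctional_D, smul_eq_mul,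
    smul_eq_mul, ← map_mul, ← map_mul, e.injective.eq_iff, toLaurent_X, invert_T,
    laurentDerivative_T, laurentDerivative_T] at h
  -- The factor `-T⁻²` is the derivative of `T⁻¹`. The left side has no negative exponents and the
  -- right side only negative ones, so both vanish.
  have h' : toLaurent p = -(invert (toLaurent q) * T (-2)) := by
    simpa using h
  have hp : p = 0 := by
    rw [← trunc_toLaurent p, h', map_neg, trunc_invert_toLaurent_mul_T q (by norm_num), neg_zero]
  have hq : q = 0 := by
    rw [hp, map_zero, eq_comm, neg_eq_zero] at h'
    have := congr($h' * T 2)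
    rw [mul_assoc, ← T_add] at this
    simpa using this
  subst hp hq
  simp

/-- The map factors as `Ω_A → B₀ ⊗ Ω_A → Ω_{B₀}`. The second arrow is injective by formal
smoothness, and the first is split by the constant coefficient `B₀ → A`. -/
lemma map_injective_of_polynomial (e₀ : A[X] ≃ₐ[A] B₀) :
    Function.Injective (map k k A B₀) := by
  have : Algebra.FormallySmooth A B₀ := .of_equiv e₀
  rw [injective_iff_map_eq_zero]
  intro ω hω
  have h : (1 : B₀) ⊗ₜ[A] ω = 0 :=
    mapBaseChange_injective_of_formallySmooth k A B₀ (by rw [mapBaseChange_tmul, hω]; simp)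
  have h' := congr(TensorProduct.lid A _ ((lcoeff A 0 ∘ₗ e₀.symm.toLinearMap).rTensor _ $h))
  simpa using h'

/-- Naturality of base change along `B → L`; it lets an equality in `Ω_L` be pulled back to `L ⊗
Ω_A`. -/
lemma mapBaseChange_rTensor {B : Type*} [CommRing B] [Algebra k B] [Algebra A B] [Algebra B L]
    [IsScalarTower k A B] [IsScalarTower k B L] [IsScalarTower A B L] (u : B ⊗[A] Ω[A⁄k]) :
    mapBaseChange k A L ((IsScalarTower.toAlgHom A B L).toLinearMap.rTensor _ u) =
      map k k B L (mapBaseChange k A B u) := by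
  induction u with
  | zero => simp
  | add u v hu hv => simp only [map_add, hu, hv]
  | tmul b ω =>
    rw [LinearMap.rTensor_tmul, mapBaseChange_tmul, mapBaseChange_tmul, (map k k B L).map_smul,
      ← algebraMap_smul L b]
    congr 1
    have hω : ω ∈ Submodule.span A (Set.range (D k A)) := by
      rw [span_range_derivation]; trivial
    induction hω using Submodule.span_induction with
    | mem z hz =>
      obtain ⟨a, rfl⟩ := hz
      rw [map_D, map_D, map_D, ← IsScalarTower.algebraMap_apply]
    | zero => simp
    | add x y _ _ hx hy => simp only [map_add, hx, hy]
    | smul a x _ hx => rw [map_smul, map_smul, LinearMap.map_smul_of_tower, hx]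

lemma map_map_base {B : Type*} [CommRing B] [Algebra k B] [Algebra A B] [Algebra B L]
    [IsScalarTower k A B] [IsScalarTower k B L] [IsScalarTower A B L] (x : Ω[B⁄k]) :
    map A A B L (map k A B B x) = map k A L L (map k k B L x) := by
  have hx : x ∈ Submodule.span B (Set.range (D k B)) := by
    rw [span_range_derivation]; trivial
  induction hx using Submodule.span_induction with
  | mem z hz => obtain ⟨b, rfl⟩ := hz; simp
  | zero => simp
  | add x y _ _ hx hy => simp only [map_add, hx, hy]
  | smul b x _ hx =>
    rw [(map k A B B).map_smul, (map A A B L).map_smul, (map k k B L).map_smul, hx,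
      ← algebraMap_smul L b, ← algebraMap_smul L b, (map k A L L).map_smul]

/-- A global differential on the projective line over `A` comes from `A`. -/
lemma exists_map_eq (e₀ : A[X] ≃ₐ[A] B₀) (e₁ : A[X] ≃ₐ[A] B₁) (e : A[T;T⁻¹] ≃ₐ[A] L)
    (h₀ : ∀ p, algebraMap B₀ L (e₀ p) = e (toLaurent p))
    (h₁ : ∀ p, algebraMap B₁ L (e₁ p) = e (invert (toLaurent p)))
    (x : Ω[B₀⁄k]) (y : Ω[B₁⁄k]) (hxy : map k k B₀ L x = map k k B₁ L y) :
    ∃ ω : Ω[A⁄k], map k k A B₀ ω = x ∧ map k k A B₁ ω = y := by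
  -- A localization of the polynomial ring: both `A → A[X]` and `A[X] → A[T;T⁻¹]` are formally
  -- smooth.
  have : Algebra.FormallySmooth A A[T;T⁻¹] := by
    have : IsScalarTower A A[X] A[T;T⁻¹] := .of_algebraMap_eq fun a => by
      rw [algebraMap_eq_toLaurent, Polynomial.algebraMap_eq, toLaurent_C,
        LaurentPolynomial.C_eq_algebraMap]
    have : Algebra.FormallySmooth A[X] A[T;T⁻¹] := .of_isLocalization (.powers X)
    exact .comp A A[X] A[T;T⁻¹]
  have : Algebra.FormallySmooth A L := .of_equiv e
  obtain ⟨hx, hy⟩ := relative_eq_zero e₀ e₁ e h₀ h₁ (map k A B₀ B₀ x) (map k A B₁ B₁ y) (by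
    rw [map_map_base, map_map_base, hxy])
  obtain ⟨u, rfl⟩ := (exact_mapBaseChange_map k A B₀ x).mp hx
  obtain ⟨v, rfl⟩ := (exact_mapBaseChange_map k A B₁ y).mp hy
  let i₀ : B₀ →ₗ[A] L := (IsScalarTower.toAlgHom A B₀ L).toLinearMap
  let i₁ : B₁ →ₗ[A] L := (IsScalarTower.toAlgHom A B₁ L).toLinearMap
  have huv : i₀.rTensor _ u = i₁.rTensor _ v := by
    apply mapBaseChange_injective_of_formallySmooth k A L
    rw [mapBaseChange_rTensor, mapBaseChange_rTensor, hxy]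
  -- `q₀` keeps the nonnegative degrees in `T` and `q₁` the nonpositive ones, so they retract `i₀`
  -- and `i₁`; `c₀` and `c₁` take constant coefficients. These maps are only `A`-linear, which is
  -- enough to tensor them with `Ω[A⁄k]`.
  let q₀ : L →ₗ[A] B₀ := e₀.toLinearMap ∘ₗ truncLinear A ∘ₗ e.symm.toLinearMap
  let q₁ : L →ₗ[A] B₁ :=
    e₁.toLinearMap ∘ₗ truncLinear A ∘ₗ invert.toLinearMap ∘ₗ e.symm.toLinearMap
  let c₀ : B₀ →ₗ[A] A := lcoeff A 0 ∘ₗ e₀.symm.toLinearMap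
  let c₁ : B₁ →ₗ[A] A := lcoeff A 0 ∘ₗ e₁.symm.toLinearMap
  have hinv (f : A[T;T⁻¹]) : invert (invert f) = f := involutive_invert f
  have hC₀ (a : A) : e₀ (Polynomial.C a) = algebraMap A B₀ a := e₀.commutes a
  have hC₁ (a : A) : e₁ (Polynomial.C a) = algebraMap A B₁ a := e₁.commutes a
  have hq₀ : q₀ ∘ₗ i₀ = LinearMap.id := by
    ext b
    obtain ⟨p, rfl⟩ := e₀.surjective b
    simp [q₀, i₀, h₀, truncLinear]
  have hq₁ : q₁ ∘ₗ i₁ = LinearMap.id := by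
    ext b
    obtain ⟨p, rfl⟩ := e₁.surjective b
    simp [q₁, i₁, h₁, truncLinear, hinv]
  have hq₀₁ : q₀ ∘ₗ i₁ = Algebra.linearMap A B₀ ∘ₗ c₁ := by
    ext b
    obtain ⟨p, rfl⟩ := e₁.surjective b
    simp [q₀, i₁, c₁, h₁, truncLinear, trunc_invert_toLaurent, hC₀]
  have hq₁₀ : q₁ ∘ₗ i₀ = Algebra.linearMap A B₁ ∘ₗ c₀ := by
    ext b
    obtain ⟨p, rfl⟩ := e₀.surjective b
    simp [q₁, i₀, c₀, h₀, truncLinear, trunc_invert_toLaurent, hC₁]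
  have hc : c₀ ∘ₗ Algebra.linearMap A B₀ = LinearMap.id := by
    ext
    simp [c₀]
  -- Apply `q₀` to `huv`: the left side returns `u`, while from `v` only the constant part survives.
  have hu : u = (Algebra.linearMap A B₀).rTensor _ (c₁.rTensor _ v) := by
    rw [← LinearMap.rTensor_comp_apply, ← hq₀₁, LinearMap.rTensor_comp_apply, ← huv,
      ← LinearMap.rTensor_comp_apply, hq₀, LinearMap.rTensor_id_apply]
  have hv : v = (Algebra.linearMap A B₁).rTensor _ (c₀.rTensor _ u) := by
    rw [← LinearMap.rTensor_comp_apply, ← hq₁₀, LinearMap.rTensor_comp_apply, huv,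
      ← LinearMap.rTensor_comp_apply, hq₁, LinearMap.rTensor_id_apply]
  have hcuv : c₀.rTensor _ u = c₁.rTensor _ v := by
    rw [hu, ← LinearMap.rTensor_comp_apply, hc, LinearMap.rTensor_id_apply]
  obtain ⟨ω, hω⟩ := (TensorProduct.lid A Ω[A⁄k]).symm.surjective (c₁.rTensor _ v)
  rw [TensorProduct.lid_symm_apply] at hω
  refine ⟨ω, ?_, ?_⟩
  · rw [hu, ← hω]; simp
  · rw [hv, hcuv, ← hω]; simp

variable {k} in
/-- Gluing of differentials on the two standard charts of the projective line over `A`. -/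
lemma exists_map_eq_of_charts (t : B₀) (s : B₁) (ht : Function.Bijective (aeval (R := A) t))
    (hs : Function.Bijective (aeval (R := A) s)) [IsLocalization.Away t L]
    (hts : algebraMap B₀ L t * algebraMap B₁ L s = 1)
    (x : Ω[B₀⁄k]) (y : Ω[B₁⁄k]) (hxy : map k k B₀ L x = map k k B₁ L y) :
    ∃ ω : Ω[A⁄k], map k k A B₀ ω = x ∧ map k k A B₁ ω = y := by
  let e₀ : A[X] ≃ₐ[A] B₀ := AlgEquiv.ofBijective _ ht
  let e₁ : A[X] ≃ₐ[A] B₁ := AlgEquiv.ofBijective _ hs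
  -- `X` corresponds to `t`, so `A[X] ≃ B₀` extends to the localizations at `X` and at `t`.
  have hT : (Submonoid.powers (X : A[X])).map e₀.toRingEquiv.toMonoidHom = .powers t := by
    rw [Submonoid.map_powers]
    congr 1
    exact aeval_X t
  let e' : A[T;T⁻¹] ≃+* L := IsLocalization.ringEquivOfRingEquiv A[T;T⁻¹] L e₀.toRingEquiv hT
  have he' (p : A[X]) : e' (toLaurent p) = algebraMap B₀ L (e₀ p) :=
    IsLocalization.ringEquivOfRingEquiv_eq hT p
  let e : A[T;T⁻¹] ≃ₐ[A] L := AlgEquiv.ofRingEquiv (f := e') fun a => by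
    rw [← LaurentPolynomial.C_eq_algebraMap, ← toLaurent_C, he', ← Polynomial.algebraMap_eq,
      AlgEquiv.commutes, ← IsScalarTower.algebraMap_apply]
  have he (p : A[X]) : e (toLaurent p) = algebraMap B₀ L (e₀ p) := he' p
  refine exists_map_eq k e₀ e₁ e (fun p => (he p).symm) (fun p => ?_) x y hxy
  -- Algebra maps out of `A[X]` are compared at `X`, where the images of `s` and `T⁻¹` are both
  -- inverse to the image of `t`.
  have h : (IsScalarTower.toAlgHom A B₁ L).comp e₁.toAlgHom =
      e.toAlgHom.comp ((invert (R := A)).toAlgHom.comp toLaurentAlg) := by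
    refine Polynomial.algHom_ext ?_
    change algebraMap B₁ L (aeval s X) = e (invert (toLaurent X))
    rw [aeval_X, toLaurent_X, invert_T]
    have h₁ : e (T 1) = algebraMap B₀ L t := by
      rw [← toLaurent_X, he]
      exact congrArg _ (aeval_X t)
    have h₂ : e (T (-1)) * e (T 1) = 1 := by
      rw [← map_mul, ← T_add]; simp
    calc _ = e (T (-1)) * e (T 1) * algebraMap B₁ L s := by rw [h₂, one_mul]
      _ = e (T (-1)) := by rw [h₁, mul_assoc, hts, mul_one]
  exact congr($h p)

end Kaehler

/-! ### Differentials of ring homomorphisms -/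

section Kah

variable {k R S : Type*} [CommRing k] [CommRing R] [CommRing S]

/-- The module of differentials of a ring homomorphism `k → R`. -/
def Kah (i : k →+* R) : Type _ :=
  letI := i.toAlgebra
  KaehlerDifferential k R

instance (i : k →+* R) : AddCommGroup (Kah i) :=
  letI := i.toAlgebra
  (inferInstance : AddCommGroup (KaehlerDifferential k R))

instance (i : k →+* R) : Module R (Kah i) :=
  letI := i.toAlgebra
  (inferInstance : Module R (KaehlerDifferential k R))

/-- The universal derivation. -/
def Kah.d (i : k →+* R) (r : R) : Kah i :=
  letI := i.toAlgebra
  KaehlerDifferential.D k R r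

@[elab_as_elim]
lemma Kah.induction (i : k →+* R) {P : Kah i → Prop} (hd : ∀ r, P (Kah.d i r)) (h0 : P 0)
    (hadd : ∀ x y, P x → P y → P (x + y)) (hsmul : ∀ (r : R) x, P x → P (r • x)) (x : Kah i) :
    P x := by
  let _ := i.toAlgebra
  have hx : (x : KaehlerDifferential k R) ∈
      Submodule.span R (Set.range (KaehlerDifferential.D k R)) := by
    rw [KaehlerDifferential.span_range_derivation]; trivial
  induction hx using Submodule.span_induction with
  | mem z hz => obtain ⟨b, rfl⟩ := hz; exact hd b
  | zero => exact h0
  | add x y _ _ hx hy => exact hadd x y hx hy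
  | smul r x _ hx => exact hsmul r x hx

variable {i : k →+* R} {j : k →+* S}

/-- The map of differentials induced by a ring homomorphism `R → S` under `k`. -/
def Kah.map (φ : R →+* S) (h : φ.comp i = j) : Kah i →ₛₗ[φ] Kah j :=
  letI := i.toAlgebra
  letI := j.toAlgebra
  letI := φ.toAlgebra
  haveI : IsScalarTower k R S := .of_algebraMap_eq' h.symm
  { toFun := KaehlerDifferential.map k k R S
    map_add' := fun x y => map_add (KaehlerDifferential.map k k R S) x y
    map_smul' := fun r x => (KaehlerDifferential.map k k R S).map_smul r x }

lemma Kah.map_d (φ : R →+* S) (h : φ.comp i = j) (r : R) :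
    Kah.map φ h (Kah.d i r) = Kah.d j (φ r) :=
  letI := i.toAlgebra
  letI := j.toAlgebra
  letI := φ.toAlgebra
  haveI : IsScalarTower k R S := .of_algebraMap_eq' h.symm
  KaehlerDifferential.map_D k k R S r

lemma Kah.map_map {T : Type*} [CommRing T] {l : k →+* T} (φ : R →+* S) (h : φ.comp i = j)
    (ψ : S →+* T) (h' : ψ.comp j = l) (χ : R →+* T) (h'' : χ.comp i = l)
    (hχ : ∀ r, ψ (φ r) = χ r) (x : Kah i) :
    Kah.map ψ h' (Kah.map φ h x) = Kah.map χ h'' x := by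
  induction x using Kah.induction with
  | hd r => rw [map_d, map_d, map_d, hχ]
  | h0 => simp
  | hadd x y hx hy => rw [map_add, map_add, hx, hy, map_add]
  | hsmul r x hx => rw [map_smulₛₗ, map_smulₛₗ, hx, map_smulₛₗ, hχ]

/-- Differentials commute with localization, so `Kah j` is `Kah i` localized at the powers of `f`.
This lemma and the next one clear denominators. -/
lemma Kah.exists_pow_smul_eq_zero (φ : R →+* S) (h : φ.comp i = j) (f : R)
    (hf : letI := φ.toAlgebra; IsLocalization.Away f S) (x : Kah i) (hx : Kah.map φ h x = 0) :
    ∃ n : ℕ, f ^ n • x = 0 := by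
  let _ := i.toAlgebra
  let _ := j.toAlgebra
  let _ := φ.toAlgebra
  have : IsScalarTower k R S := .of_algebraMap_eq' h.symm
  have : IsLocalization (.powers f) S := hf
  obtain ⟨⟨_, n, rfl⟩, hn⟩ := (IsLocalizedModule.eq_zero_iff (.powers f)
    (KaehlerDifferential.map k k R S)).mp hx
  exact ⟨n, hn⟩

lemma Kah.exists_map_eq_pow_smul (φ : R →+* S) (h : φ.comp i = j) (f : R)
    (hf : letI := φ.toAlgebra; IsLocalization.Away f S) (x : Kah j) :
    ∃ (n : ℕ) (y : Kah i), Kah.map φ h y = φ f ^ n • x := by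
  let _ := i.toAlgebra
  let _ := j.toAlgebra
  let _ := φ.toAlgebra
  have : IsScalarTower k R S := .of_algebraMap_eq' h.symm
  have : IsLocalization (.powers f) S := hf
  obtain ⟨⟨y, ⟨_, n, rfl⟩⟩, hn⟩ := IsLocalizedModule.surj (.powers f)
    (KaehlerDifferential.map k k R S) x
  refine ⟨n, y, hn.symm.trans ?_⟩
  rw [← map_pow]
  exact (algebraMap_smul (M := KaehlerDifferential k S) S (f ^ n) x).symm

lemma Kah.map_injective_of_polynomial (φ : R →+* S) (h : φ.comp i = j) (t : S)
    (ht : Function.Bijective (Polynomial.eval₂RingHom φ t)) : Function.Injective (Kah.map φ h) := by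
  let _ := i.toAlgebra
  let _ := j.toAlgebra
  let _ := φ.toAlgebra
  have : IsScalarTower k R S := .of_algebraMap_eq' h.symm
  exact RuledSurface.map_injective_of_polynomial k
    (AlgEquiv.ofBijective (Polynomial.aeval (R := R) t) ht)

/-- The form of `exists_map_eq_of_charts` suited to rings of sections, where the structure maps are
explicit homomorphisms instead of algebra instances. -/
lemma Kah.exists_of_charts {B₀ B₁ L : Type*} [CommRing B₀] [CommRing B₁] [CommRing L]
    {i₀ : k →+* B₀} {i₁ : k →+* B₁} {l : k →+* L} {φ₀ : R →+* B₀} {φ₁ : R →+* B₁}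
    {ψ₀ : B₀ →+* L} {ψ₁ : B₁ →+* L} (h₀ : φ₀.comp i = i₀) (h₁ : φ₁.comp i = i₁)
    (hψ₀ : ψ₀.comp i₀ = l) (hψ₁ : ψ₁.comp i₁ = l) (hψ : ψ₀.comp φ₀ = ψ₁.comp φ₁)
    (t : B₀) (s : B₁) (ht : Function.Bijective (Polynomial.eval₂RingHom φ₀ t))
    (hs : Function.Bijective (Polynomial.eval₂RingHom φ₁ s))
    (hL : letI := ψ₀.toAlgebra; IsLocalization.Away t L) (hts : ψ₀ t * ψ₁ s = 1)
    (x : Kah i₀) (y : Kah i₁) (hxy : Kah.map ψ₀ hψ₀ x = Kah.map ψ₁ hψ₁ y) :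
    ∃ ω : Kah i, Kah.map φ₀ h₀ ω = x ∧ Kah.map φ₁ h₁ ω = y := by
  let _ := i.toAlgebra
  let _ := i₀.toAlgebra
  let _ := i₁.toAlgebra
  let _ := l.toAlgebra
  let _ := φ₀.toAlgebra
  let _ := φ₁.toAlgebra
  let _ := ψ₀.toAlgebra
  let _ := ψ₁.toAlgebra
  -- `L` becomes an `R`-algebra through the first chart; `hψ` makes the tower through the second
  -- chart commute as well.
  let _ := (ψ₀.comp φ₀).toAlgebra
  have : IsScalarTower k R B₀ := .of_algebraMap_eq' h₀.symm
  have : IsScalarTower k R B₁ := .of_algebraMap_eq' h₁.symm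
  have : IsScalarTower k B₀ L := .of_algebraMap_eq' hψ₀.symm
  have : IsScalarTower k B₁ L := .of_algebraMap_eq' hψ₁.symm
  have : IsScalarTower R B₀ L := .of_algebraMap_eq' rfl
  have : IsScalarTower R B₁ L := .of_algebraMap_eq' hψ
  have : IsScalarTower k R L := .of_algebraMap_eq' (by
    rw [← hψ₀, ← h₀]; rfl : l = (ψ₀.comp φ₀).comp i)
  exact exists_map_eq_of_charts (k := k) t s ht hs hts x y hxy

end Kah

/-! ### Sections of the cotangent sheaf over affine opens -/

section Affine

variable {k : Type u} [Field k] {X : Scheme.{u}} (x : X ⟶ Spec (.of k))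

/-- The structure map `k → 𝒪(V)`. -/
abbrev structMap (V : X.Opens) : k →+* Γ(X, V) := ((constToPresheaf x).app (Opposite.op V)).hom

lemma resMap_comp_structMap {V W : X.Opens} (h : W ≤ V) :
    (X.presheaf.map (homOfLE h).op).hom.comp (structMap x V) = structMap x W := by
  have := (constToPresheaf x).naturality (homOfLE h).op
  exact congrArg CommRingCat.Hom.hom this.symm

/-- The restriction of differentials. -/
abbrev kahRes {V W : X.Opens} (h : W ≤ V) :
    Kah (structMap x V) →ₛₗ[(X.presheaf.map (homOfLE h).op).hom] Kah (structMap x W) :=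
  Kah.map _ (resMap_comp_structMap x h)

/-- The map from the differentials of `𝒪(V)` to the sections of the cotangent sheaf. -/
def kahToOmega (V : X.Opens) : Kah (structMap x V) →ₗ[Γ(X, V)] Γ(Omega x, V) where
  toFun := (toOmega x).app (Opposite.op V)
  map_add' a b := ((toOmega x).app (Opposite.op V)).hom.map_add a b
  map_smul' r a := ((toOmega x).app (Opposite.op V)).hom.map_smul r a

lemma kahToOmega_d (V : X.Opens) (f : Γ(X, V)) :
    kahToOmega x V (Kah.d _ f) = omegaDOn x V f := rfl

lemma kahToOmega_res {V W : X.Opens} (h : W ≤ V) (ω : Kah (structMap x V)) :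
    kahToOmega x W (kahRes x h ω) = res (Omega x) h (kahToOmega x V ω) := by
  induction ω using Kah.induction with
  | hd r =>
    rw [Kah.map_d, kahToOmega_d, kahToOmega_d]
    exact omegaDOn_map x (homOfLE h) r
  | h0 => simp
  | hadd x y hx hy => rw [map_add, map_add, hx, hy, map_add, map_add]
  | hsmul r x hx => rw [map_smulₛₗ, map_smul, hx, map_smul, map_smulₛₗ]

/-- The unit of sheafification is locally injective; likewise it is locally surjective, which gives
the next lemma. -/
lemma kahToOmega_locally_injective (V : X.Opens) (ω : Kah (structMap x V))
    (hω : kahToOmega x V ω = 0) (p : X) (hp : p ∈ V) :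
    ∃ (W : X.Opens) (h : W ≤ V), p ∈ W ∧ kahRes x h ω = 0 := by
  have := Presheaf.equalizerSieve_mem (Opens.grothendieckTopology X)
    (CategoryTheory.toSheafify (Opens.grothendieckTopology X) (presheafOmega x).presheaf)
    (X := Opposite.op V) ω 0 (hω.trans (map_zero (kahToOmega x V)).symm)
  obtain ⟨W, f, hf, hW⟩ := this p hp
  refine ⟨W, leOfHom f, hW, ?_⟩
  exact hf.trans (map_zero (kahRes x (leOfHom f)))

lemma kahToOmega_locally_surjective (V : X.Opens) (s : Γ(Omega x, V)) (p : X) (hp : p ∈ V) :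
    ∃ (W : X.Opens) (h : W ≤ V) (ω : Kah (structMap x W)), p ∈ W ∧
      kahToOmega x W ω = res (Omega x) h s := by
  have := Presheaf.imageSieve_mem (Opens.grothendieckTopology X)
    (CategoryTheory.toSheafify (Opens.grothendieckTopology X) (presheafOmega x).presheaf)
    (U := Opposite.op V) s
  obtain ⟨W, f, ⟨ω, hω⟩, hW⟩ := this p hp
  exact ⟨W, leOfHom f, ω, hW, hω⟩

/-- The basic opens of elements of the radical of `I` cover `V`, so the radical is the unit ideal.
This local-to-global principle is applied to annihilators and to ideals of the form `{r | r • s ∈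
N}`. -/
lemma ideal_eq_top_of_basicOpen {V : X.Opens} (hV : IsAffineOpen V) (I : Ideal Γ(X, V))
    (hI : ∀ p ∈ V, ∃ f : Γ(X, V), p ∈ X.basicOpen f ∧ ∃ n : ℕ, f ^ n ∈ I) : I = ⊤ := by
  rw [← Ideal.radical_eq_top, ← Ideal.span_eq I.radical, ← hV.self_le_iSup_basicOpen_iff]
  intro p hp
  obtain ⟨f, hpf, n, hn⟩ := hI p hp
  exact Opens.mem_iSup.mpr ⟨⟨f, n, hn⟩, hpf⟩

lemma isLocalization_res_basicOpen {V W : X.Opens} (hV : IsAffineOpen V) (f : Γ(X, V))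
    (h : W ≤ V) (hW : W = X.basicOpen f) :
    letI := (X.presheaf.map (homOfLE h).op).hom.toAlgebra
    IsLocalization.Away f Γ(X, W) :=
  hV.isLocalization_of_eq_basicOpen f (homOfLE h) hW

/-- Sections of a sheaf of modules which agree locally are equal. -/
lemma eq_of_locally_res_eq (M : X.Modules) {V : X.Opens} (s t : Γ(M, V))
    (h : ∀ p ∈ V, ∃ (W : X.Opens) (hW : W ≤ V), p ∈ W ∧ res M hW s = res M hW t) : s = t := by
  choose W hW hpW hst using fun p : V => h p p.2
  refine TopCat.Sheaf.eq_of_locally_eq' (⟨M.presheaf, M.isSheaf⟩ : TopCat.Sheaf Ab X) W V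
    (fun p => homOfLE (hW p)) (fun p hp => Opens.mem_iSup.mpr ⟨⟨p, hp⟩, hpW _⟩) s t hst

lemma kahToOmega_injective {V : X.Opens} (hV : IsAffineOpen V) :
    Function.Injective (kahToOmega x V) := by
  rw [injective_iff_map_eq_zero]
  intro ω hω
  -- The kernel is the annihilator of `ω`. Near each point `ω` dies on some basic open, hence is
  -- killed by a power of its equation.
  have : Ideal.span {1} ≤ LinearMap.ker (LinearMap.toSpanSingleton Γ(X, V) _ ω) := by
    rw [ideal_eq_top_of_basicOpen hV (LinearMap.ker (LinearMap.toSpanSingleton Γ(X, V) _ ω))]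
    · exact le_top
    intro p hp
    obtain ⟨W, hW, hpW, hωW⟩ := kahToOmega_locally_injective x V ω hω p hp
    obtain ⟨f, hfW, hpf⟩ := hV.exists_basicOpen_le ⟨p, hpW⟩ hp
    refine ⟨f, hpf, ?_⟩
    obtain ⟨n, hn⟩ := Kah.exists_pow_smul_eq_zero _
      (resMap_comp_structMap x (X.basicOpen_le f)) f
      (isLocalization_res_basicOpen hV f _ rfl) ω (by
        have := Kah.map_map _ (resMap_comp_structMap x hW) _ (resMap_comp_structMap x hfW) _
          (resMap_comp_structMap x (X.basicOpen_le f))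
          (fun r => congr($(X.presheaf.map_comp (homOfLE hW).op (homOfLE hfW).op) r).symm) ω
        rw [← this, hωW, map_zero])
    exact ⟨n, hn⟩
  simpa using this (Ideal.subset_span rfl)

lemma exists_kahToOmega_basicOpen {V : X.Opens} (hV : IsAffineOpen V) (s : Γ(Omega x, V)) (p : X)
    (hp : p ∈ V) : ∃ (f : Γ(X, V)) (ω : Kah (structMap x (X.basicOpen f))), p ∈ X.basicOpen f ∧
      kahToOmega x _ ω = res (Omega x) (X.basicOpen_le f) s := by
  obtain ⟨W, hW, ω, hpW, hω⟩ := kahToOmega_locally_surjective x V s p hp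
  obtain ⟨f, hfW, hpf⟩ := hV.exists_basicOpen_le ⟨p, hpW⟩ hp
  exact ⟨f, kahRes x hfW ω, hpf, by rw [kahToOmega_res, hω, res_res]⟩

/-- A section over an affine open which vanishes where `g` does not is killed by a power of `g`. -/
lemma exists_pow_smul_omega_eq_zero {V : X.Opens} (hV : IsAffineOpen V) (g : Γ(X, V))
    (s : Γ(Omega x, V)) (hs : res (Omega x) (X.basicOpen_le g) s = 0) :
    ∃ n : ℕ, g ^ n • s = 0 := by
  -- Each point has its own exponent; compactness of `V` yields a common one, with exponents added
  -- for a union of two sets.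
  have key : ∃ n : ℕ, ∀ p ∈ (V : Set X), ∃ (W : X.Opens) (hW : W ≤ V), p ∈ W ∧
      res (Omega x) hW (g ^ n • s) = 0 := by
    refine hV.isCompact.induction_on (p := fun K => ∃ n : ℕ, ∀ p ∈ K, ∃ (W : X.Opens)
      (hW : W ≤ V), p ∈ W ∧ res (Omega x) hW (g ^ n • s) = 0) ⟨0, by simp⟩ ?_ ?_ ?_
    · rintro K K' hK ⟨n, hn⟩
      exact ⟨n, fun p hp => hn p (hK hp)⟩
    · rintro K K' ⟨n, hn⟩ ⟨m, hm⟩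
      refine ⟨n + m, fun p hp => ?_⟩
      rcases hp with hp | hp
      · obtain ⟨W, hW, hpW, h⟩ := hn p hp
        exact ⟨W, hW, hpW, by rw [add_comm, pow_add, mul_smul, map_smulₛₗ, h, smul_zero]⟩
      · obtain ⟨W, hW, hpW, h⟩ := hm p hp
        exact ⟨W, hW, hpW, by rw [pow_add, mul_smul, map_smulₛₗ, h, smul_zero]⟩
    · intro p hp
      obtain ⟨f, ω, hpf, hω⟩ := exists_kahToOmega_basicOpen x hV s p hp
      let g' : Γ(X, X.basicOpen f) := X.presheaf.map (homOfLE (X.basicOpen_le f)).op g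
      have hg' : X.basicOpen g' ≤ X.basicOpen g := by
        rw [X.basicOpen_res]; exact inf_le_right
      -- On `X.basicOpen f` the section is an honest differential `ω`. It vanishes where `g'` is
      -- invertible, by injectivity there, so a power of `g'` kills it.
      obtain ⟨n, hn⟩ := Kah.exists_pow_smul_eq_zero _
        (resMap_comp_structMap x (X.basicOpen_le g')) g'
        (isLocalization_res_basicOpen (hV.basicOpen f) g' _ rfl) ω (by
          apply kahToOmega_injective x ((hV.basicOpen f).basicOpen g')
          rw [kahToOmega_res, hω, res_res, ← res_res _ (X.basicOpen_le g) hg', hs, map_zero,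
            map_zero])
      refine ⟨X.basicOpen f, mem_nhdsWithin_of_mem_nhds ((X.basicOpen f).isOpen.mem_nhds hpf), n,
        fun q hq => ⟨X.basicOpen f, X.basicOpen_le f, hq, ?_⟩⟩
      rw [map_smulₛₗ, ← hω, map_pow]
      rw [← map_zero (kahToOmega x _), ← hn, map_smul]
  obtain ⟨n, hn⟩ := key
  refine ⟨n, eq_of_locally_res_eq _ _ _ fun p hp => ?_⟩
  obtain ⟨W, hW, hpW, h⟩ := hn p hp
  exact ⟨W, hW, hpW, by rw [h, map_zero]⟩

/-- Over an affine open `V`, the sections of the cotangent sheaf are the differentials of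
`𝒪(V)`. -/
theorem kahToOmega_bijective {V : X.Opens} (hV : IsAffineOpen V) :
    Function.Bijective (kahToOmega x V) := by
  refine ⟨kahToOmega_injective x hV, fun s => ?_⟩
  -- The ideal of those `r` for which `r • s` comes from a differential over `V`; the aim is `1 ∈
  -- I`.
  let I : Ideal Γ(X, V) :=
    (LinearMap.range (kahToOmega x V)).comap (LinearMap.toSpanSingleton Γ(X, V) _ s)
  have hI : I = ⊤ := by
    refine ideal_eq_top_of_basicOpen hV I fun p hp => ?_
    obtain ⟨f, ω, hpf, hω⟩ := exists_kahToOmega_basicOpen x hV s p hp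
    obtain ⟨n, ω', hω'⟩ := Kah.exists_map_eq_pow_smul _
      (resMap_comp_structMap x (X.basicOpen_le f)) f (isLocalization_res_basicOpen hV f _ rfl) ω
    -- `f ^ n • s` and the image of `ω'` agree only on `X.basicOpen f`; a further power of `f` makes
    -- them agree on `V`.
    obtain ⟨m, hm⟩ := exists_pow_smul_omega_eq_zero x hV f (f ^ n • s - kahToOmega x V ω') (by
      rw [map_sub, ← kahToOmega_res, hω', (kahToOmega x _).map_smul, hω, map_smulₛₗ, map_pow,
        sub_self])
    refine ⟨f, hpf, m + n, f ^ m • ω', ?_⟩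
    rw [smul_sub, sub_eq_zero] at hm
    rw [map_smul, ← hm, LinearMap.toSpanSingleton_apply, pow_add, mul_smul]
  have h1 : (1 : Γ(X, V)) ∈ I := hI ▸ Submodule.mem_top
  simpa [I] using h1

end Affine

/-! ### The natural map on sections -/

section Eta

variable {k : Type u} [Field k] {X C : Scheme.{u}} (π : X ⟶ C) (c : C ⟶ Spec (.of k))

lemma appLE_comp_structMap {U : C.Opens} {V : X.Opens} (h : V ≤ π ⁻¹ᵁ U) :
    (π.appLE U V h).hom.comp (structMap c U) = structMap (π ≫ c) V := by
  rw [← resMap_comp_structMap (π ≫ c) h]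
  have := constToPresheaf_app π c U
  rw [structMap, structMap, ← this]
  rfl

/-- The natural map on sections over `U`. -/
def etaOn (U : C.Opens) :
    Γ(Omega c, U) →ₛₗ[(π.app U).hom] Γ(Omega (π ≫ c), π ⁻¹ᵁ U) where
  toFun := (eta π c).app U
  map_add' := ((eta π c).app U).hom.map_add
  map_smul' := (eta π c).app_smul

/-- Both sides are semilinear in `ω` and agree on exact differentials. This identifies `eta` on
charts with the algebraic map of Kähler differentials. -/
lemma res_etaOn_kahToOmega {U : C.Opens} {V : X.Opens} (h : V ≤ π ⁻¹ᵁ U)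
    (ω : Kah (structMap c U)) :
    res (Omega (π ≫ c)) h (etaOn π c U (kahToOmega c U ω)) =
      kahToOmega (π ≫ c) V (Kah.map _ (appLE_comp_structMap π c h) ω) := by
  induction ω using Kah.induction with
  | hd r =>
    rw [Kah.map_d, kahToOmega_d, kahToOmega_d]
    refine (congrArg (res (Omega (π ≫ c)) h) (eta_omegaDOn π c U r)).trans ?_
    exact (omegaDOn_map (π ≫ c) (homOfLE h) _).symm
  | h0 => simp
  | hadd x y hx hy => rw [map_add, map_add, map_add, map_add, map_add, ← hx, ← hy]
  | hsmul r x hx =>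
    rw [(Kah.map _ _).map_smulₛₗ, (kahToOmega c U).map_smul, (kahToOmega (π ≫ c) V).map_smul, ← hx,
      map_smulₛₗ, map_smulₛₗ]
    rfl

/-- A section over `π ⁻¹ᵁ U` amounts to two Kähler differentials agreeing on the overlap. One chart
suffices for injectivity; surjectivity is `Kah.exists_of_charts` followed by a local comparison. -/
theorem etaOn_bijective {U : C.Opens} (hU : IsAffineOpen U) {V₀ V₁ : X.Opens}
    (hV₀ : IsAffineOpen V₀) (hV₁ : IsAffineOpen V₁) (h₀ : V₀ ≤ π ⁻¹ᵁ U) (h₁ : V₁ ≤ π ⁻¹ᵁ U)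
    (hcov : π ⁻¹ᵁ U ≤ V₀ ⊔ V₁) (t : Γ(X, V₀)) (s : Γ(X, V₁)) (ht : V₀ ⊓ V₁ = X.basicOpen t)
    (hts : X.presheaf.map (homOfLE (inf_le_left : V₀ ⊓ V₁ ≤ V₀)).op t *
      X.presheaf.map (homOfLE (inf_le_right : V₀ ⊓ V₁ ≤ V₁)).op s = 1)
    (bij₀ : Function.Bijective (Polynomial.eval₂RingHom (π.appLE U V₀ h₀).hom t))
    (bij₁ : Function.Bijective (Polynomial.eval₂RingHom (π.appLE U V₁ h₁).hom s)) :
    Function.Bijective (etaOn π c U) := by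
  have hinf : IsAffineOpen (V₀ ⊓ V₁) := ht ▸ hV₀.basicOpen t
  constructor
  · rw [injective_iff_map_eq_zero]
    intro a ha
    obtain ⟨ω, rfl⟩ := (kahToOmega_bijective c hU).2 a
    have h : kahToOmega (π ≫ c) V₀ (Kah.map _ (appLE_comp_structMap π c h₀) ω) = 0 := by
      rw [← res_etaOn_kahToOmega, ha, map_zero]
    rw [← map_zero (kahToOmega (π ≫ c) V₀)] at h
    have h' := kahToOmega_injective (π ≫ c) hV₀ h
    rw [← map_zero (Kah.map _ (appLE_comp_structMap π c h₀))] at h'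
    rw [Kah.map_injective_of_polynomial _ _ t bij₀ h', map_zero]
  · intro a
    obtain ⟨x, hx⟩ := (kahToOmega_bijective (π ≫ c) hV₀).2 (res (Omega (π ≫ c)) h₀ a)
    obtain ⟨y, hy⟩ := (kahToOmega_bijective (π ≫ c) hV₁).2 (res (Omega (π ≫ c)) h₁ a)
    obtain ⟨ω, hω₀, hω₁⟩ := Kah.exists_of_charts (appLE_comp_structMap π c h₀)
      (appLE_comp_structMap π c h₁)
      (resMap_comp_structMap (π ≫ c) (inf_le_left : V₀ ⊓ V₁ ≤ V₀))
      (resMap_comp_structMap (π ≫ c) (inf_le_right : V₀ ⊓ V₁ ≤ V₁))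
      (by
        rw [← CommRingCat.hom_comp, ← CommRingCat.hom_comp, Scheme.Hom.appLE_map,
          Scheme.Hom.appLE_map])
      t s bij₀ bij₁ (isLocalization_res_basicOpen hV₀ t _ ht) hts x y (by
        -- The overlap is affine, so agreement of `x` and `y` there can be tested in the cotangent
        -- sheaf, where both restrict from `a`.
        apply kahToOmega_injective (π ≫ c) hinf
        rw [kahToOmega_res, kahToOmega_res, hx, hy, res_res, res_res])
    refine ⟨kahToOmega c U ω, ?_⟩
    refine eq_of_locally_res_eq (Omega (π ≫ c)) (V := π ⁻¹ᵁ U) _ _ fun p hp => ?_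
    rcases hcov hp with hp | hp
    · exact ⟨V₀, h₀, hp, by rw [res_etaOn_kahToOmega, hω₀, hx]⟩
    · exact ⟨V₁, h₁, hp, by rw [res_etaOn_kahToOmega, hω₁, hy]⟩

/-- Passing to underlying presheaves of abelian groups reflects isomorphisms, and a morphism of
sheaves is an isomorphism once it is one on a basis. -/
lemma isIso_eta_of_basis {ι : Type u} {B : ι → C.Opens} (hB : Opens.IsBasis (Set.range B))
    (h : ∀ i, Function.Bijective (etaOn π c (B i))) : IsIso (eta π c) := by
  rw [← isIso_iff_of_reflects_iso _ (Scheme.Modules.toPresheaf C)]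
  let φ : (⟨(Omega c).presheaf, (Omega c).isSheaf⟩ : TopCat.Sheaf Ab C) ⟶
      ⟨((Scheme.Modules.pushforward π).obj (Omega (π ≫ c))).presheaf,
        ((Scheme.Modules.pushforward π).obj (Omega (π ≫ c))).isSheaf⟩ :=
    ⟨(eta π c).mapPresheaf⟩
  have : IsIso φ := TopCat.Sheaf.isIso_iff_isIso_basis hB fun i => by
    rw [ConcreteCategory.isIso_iff_bijective]
    exact h i
  exact inferInstanceAs (IsIso ((sheafToPresheaf _ _).map φ))

end Eta

/-! ### Charts of the ruled surface -/

section EvalSpec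

variable {X C : Scheme.{u}} {B B' : CommRingCat.{u}}

/-- The pullback of functions along a morphism from an affine scheme. -/
def pullbackSpec (f : Spec B ⟶ X) (V : X.Opens) (h : ⊤ ≤ f ⁻¹ᵁ V) : Γ(X, V) ⟶ B :=
  f.appLE V ⊤ h ≫ (Scheme.ΓSpecIso B).hom

lemma pullbackSpec_map_comp (f : Spec B ⟶ X) (V : X.Opens) (h : ⊤ ≤ f ⁻¹ᵁ V) (ψ : B ⟶ B')
    (h' : ⊤ ≤ (Spec.map ψ ≫ f) ⁻¹ᵁ V) :
    pullbackSpec (Spec.map ψ ≫ f) V h' = pullbackSpec f V h ≫ ψ := by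
  have hψ : (Spec.map ψ).appTop = (Spec.map ψ).appLE ⊤ ⊤
      (le_of_eq rfl : (⊤ : (Spec B').Opens) ≤ Spec.map ψ ⁻¹ᵁ ⊤) := Scheme.Hom.app_eq_appLE _
  rw [pullbackSpec, pullbackSpec, Category.assoc, ← Scheme.ΓSpecIso_naturality, hψ,
    ← Category.assoc, Scheme.Hom.appLE_comp_appLE]

lemma presheaf_map_pullbackSpec (f : Spec B ⟶ X) {V W : X.Opens} (hWV : W ≤ V)
    (h : ⊤ ≤ f ⁻¹ᵁ V) (h' : ⊤ ≤ f ⁻¹ᵁ W) :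
    X.presheaf.map (homOfLE hWV).op ≫ pullbackSpec f W h' = pullbackSpec f V h := by
  rw [pullbackSpec, pullbackSpec, ← Category.assoc, Scheme.Hom.map_appLE]

lemma appLE_pullbackSpec (f : Spec B ⟶ X) (π : X ⟶ C) {U : C.Opens} {V : X.Opens}
    (hVU : V ≤ π ⁻¹ᵁ U) (h : ⊤ ≤ f ⁻¹ᵁ V) (h' : ⊤ ≤ (f ≫ π) ⁻¹ᵁ U) :
    π.appLE U V hVU ≫ pullbackSpec f V h = pullbackSpec (f ≫ π) U h' := by
  rw [pullbackSpec, pullbackSpec, ← Category.assoc, Scheme.Hom.appLE_comp_appLE]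

lemma pullbackSpec_fromSpec {U : C.Opens} (hU : IsAffineOpen U) (h : ⊤ ≤ hU.fromSpec ⁻¹ᵁ U) :
    pullbackSpec hU.fromSpec U h = 𝟙 _ := by
  rw [pullbackSpec, Scheme.Hom.appLE, hU.fromSpec_app_self, Category.assoc, Category.assoc,
    ← Functor.map_comp_assoc, Iso.inv_comp_eq, Category.comp_id]
  convert! Category.id_comp _

lemma top_le_preimage_opensRange (f : Spec B ⟶ X) [IsOpenImmersion f] :
    ⊤ ≤ f ⁻¹ᵁ f.opensRange := fun p _ => ⟨p, rfl⟩

lemma isIso_pullbackSpec (f : Spec B ⟶ X) [IsOpenImmersion f] {V : X.Opens}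
    (hV : V = f.opensRange) (h : ⊤ ≤ f ⁻¹ᵁ V) : IsIso (pullbackSpec f V h) := by
  have hV' : V = f ''ᵁ ⊤ := by rw [hV, Scheme.Hom.image_top_eq_opensRange]
  subst hV'
  rw [pullbackSpec, ← Scheme.Hom.appIso_hom']
  infer_instance

/-- Turns a commuting triangle of schemes over `U` into one of rings: in chart coordinates, pullback
along `π` is `φ`. -/
lemma pullbackSpec_base (f : Spec B ⟶ X) (π : X ⟶ C) {U : C.Opens} (hU : IsAffineOpen U)
    (φ : Γ(C, U) ⟶ B) (hf : f ≫ π = Spec.map φ ≫ hU.fromSpec) {V : X.Opens}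
    (hVU : V ≤ π ⁻¹ᵁ U) (h : ⊤ ≤ f ⁻¹ᵁ V) : π.appLE U V hVU ≫ pullbackSpec f V h = φ := by
  have h' : ⊤ ≤ (f ≫ π) ⁻¹ᵁ U := fun p hp => hVU (h hp)
  rw [appLE_pullbackSpec f π hVU h h']
  have h'' : ⊤ ≤ hU.fromSpec ⁻¹ᵁ U := hU.fromSpec_preimage_self.ge
  -- The inclusion proof depends on the morphism, so the morphism is generalized before `hf` is
  -- substituted.
  have key : ∀ (g : Spec B ⟶ C) (_ : g = Spec.map φ ≫ hU.fromSpec) (hg : ⊤ ≤ g ⁻¹ᵁ U),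
      pullbackSpec g U hg = φ := by
    rintro _ rfl hg
    rw [pullbackSpec_map_comp _ _ h'', pullbackSpec_fromSpec, Category.id_comp]
  exact key _ hf h'

end EvalSpec

/-! ### From charts given as morphisms from affine schemes to affine opens of `X`. -/

section TwoCharts

variable {k : Type u} [Field k] {X C : Scheme.{u}} (π : X ⟶ C) (c : C ⟶ Spec (.of k))

lemma bijective_eval₂_of_iso {A B B' : Type*} [CommRing A] [CommRing B] [CommRing B'] (φ : A →+* B)
    (φ' : A →+* B') (e : B →+* B') (he : Function.Bijective e) (hφ : e.comp φ = φ') (t : B)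
    (t' : B') (ht : e t = t') (h : Function.Bijective (Polynomial.eval₂RingHom φ' t')) :
    Function.Bijective (Polynomial.eval₂RingHom φ t) := by
  have : e.comp (Polynomial.eval₂RingHom φ t) = Polynomial.eval₂RingHom φ' t' := by
    subst hφ ht
    ext <;> simp
  rw [← this, RingHom.coe_comp] at h
  exact (Function.Bijective.of_comp_iff' he _).mp h

/-- The natural map is bijective over an affine open over which `π` is a projective line, glued
from two affine lines along `s = t⁻¹`. -/
theorem etaOn_bijective_of_charts {U : C.Opens} (hU : IsAffineOpen U) {B₀ B₁ L : CommRingCat.{u}}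
    (j₀ : Spec B₀ ⟶ X) (j₁ : Spec B₁ ⟶ X) [IsOpenImmersion j₀] [IsOpenImmersion j₁]
    (ψ₀ : B₀ ⟶ L) (ψ₁ : B₁ ⟶ L) (hψ : Spec.map ψ₀ ≫ j₀ = Spec.map ψ₁ ≫ j₁)
    [IsOpenImmersion (Spec.map ψ₀)]
    (hrange : (Spec.map ψ₀ ≫ j₀).opensRange = j₀.opensRange ⊓ j₁.opensRange)
    (hcov : π ⁻¹ᵁ U = j₀.opensRange ⊔ j₁.opensRange)
    (φ₀ : Γ(C, U) ⟶ B₀) (φ₁ : Γ(C, U) ⟶ B₁) (h₀ : j₀ ≫ π = Spec.map φ₀ ≫ hU.fromSpec)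
    (h₁ : j₁ ≫ π = Spec.map φ₁ ≫ hU.fromSpec) (t : B₀) (s : B₁) (hts : ψ₀ t * ψ₁ s = 1)
    (ht : j₀ ⁻¹ᵁ j₁.opensRange = PrimeSpectrum.basicOpen t)
    (bij₀ : Function.Bijective (Polynomial.eval₂RingHom φ₀.hom t))
    (bij₁ : Function.Bijective (Polynomial.eval₂RingHom φ₁.hom s)) :
    Function.Bijective (etaOn π c U) := by
  have hle₀ : j₀.opensRange ≤ π ⁻¹ᵁ U := hcov ▸ le_sup_left
  have hle₁ : j₁.opensRange ≤ π ⁻¹ᵁ U := hcov ▸ le_sup_right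
  have i₀ := isIso_pullbackSpec j₀ rfl (top_le_preimage_opensRange j₀)
  have i₁ := isIso_pullbackSpec j₁ rfl (top_le_preimage_opensRange j₁)
  have b₀ := ConcreteCategory.bijective_of_isIso (pullbackSpec j₀ _ (top_le_preimage_opensRange j₀))
  have b₁ := ConcreteCategory.bijective_of_isIso (pullbackSpec j₁ _ (top_le_preimage_opensRange j₁))
  obtain ⟨t', rfl⟩ := b₀.2 t
  obtain ⟨s', rfl⟩ := b₁.2 s
  have hin : ⊤ ≤ (Spec.map ψ₀ ≫ j₀) ⁻¹ᵁ (j₀.opensRange ⊓ j₁.opensRange) :=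
    hrange ▸ top_le_preimage_opensRange _
  have hin₁ : ⊤ ≤ (Spec.map ψ₀ ≫ j₀) ⁻¹ᵁ j₁.opensRange := hin.trans fun _ h => h.2
  refine etaOn_bijective π c hU (isAffineOpen_opensRange j₀) (isAffineOpen_opensRange j₁)
    hle₀ hle₁ hcov.le t' s' ?_ ?_ ?_ ?_
  -- Preimages under `j₀` determine the parts of both opens inside its range, and `X.basicOpen t'`
  -- lies there entirely.
  · have h : j₀ ⁻¹ᵁ X.basicOpen t' = j₀ ⁻¹ᵁ j₁.opensRange := by
      rw [ht, pullbackSpec, CommRingCat.comp_apply, ← basicOpen_eq_of_affine',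
        Scheme.basicOpen_appLE, top_inf_eq]
    have h' := congr(j₀ ''ᵁ $h)
    rw [Scheme.Hom.image_preimage_eq_opensRange_inf,
      Scheme.Hom.image_preimage_eq_opensRange_inf] at h'
    rw [← h', inf_eq_right.mpr (X.basicOpen_le t')]
  -- Functions on the overlap are identified with `L`, where the relation is `hts`.
  · have := isIso_pullbackSpec (Spec.map ψ₀ ≫ j₀) hrange.symm hin
    apply (ConcreteCategory.bijective_of_isIso (pullbackSpec (Spec.map ψ₀ ≫ j₀) _ hin)).1
    have e₀ := (presheaf_map_pullbackSpec (Spec.map ψ₀ ≫ j₀)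
      (inf_le_left : j₀.opensRange ⊓ j₁.opensRange ≤ _) (hin.trans fun _ h => h.1) hin).trans
      (pullbackSpec_map_comp j₀ _ (top_le_preimage_opensRange j₀) ψ₀ _)
    have e₁ : X.presheaf.map (homOfLE (inf_le_right : j₀.opensRange ⊓ j₁.opensRange ≤ _)).op ≫
        pullbackSpec (Spec.map ψ₀ ≫ j₀) _ hin =
          pullbackSpec j₁ _ (top_le_preimage_opensRange j₁) ≫ ψ₁ := by
      rw [presheaf_map_pullbackSpec _ _ hin₁, ← pullbackSpec_map_comp _ _ _ _ (hψ ▸ hin₁)]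
      congr 1
    rw [map_mul, map_one, ← hts]
    exact congr($(ConcreteCategory.congr_hom e₀ t') * $(ConcreteCategory.congr_hom e₁ s'))
  · exact bijective_eval₂_of_iso _ _ _ b₀ (congrArg CommRingCat.Hom.hom
      (pullbackSpec_base j₀ π hU φ₀ h₀ hle₀ _)) _ _ rfl bij₀
  · exact bijective_eval₂_of_iso _ _ _ b₁ (congrArg CommRingCat.Hom.hom
      (pullbackSpec_base j₁ π hU φ₁ h₁ hle₁ _)) _ _ rfl bij₁

end TwoCharts

/-! ### The two standard charts of `Proj (Sym M)` for `M` free of rank two. -/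

section ProjCharts

open HomogeneousLocalization

variable {R M : Type u} [CommRing R] [AddCommGroup M] [Module R M] (b : Module.Basis (Fin 2) R M)

/-- The ratio `x_j / x_i` on the chart of `Proj (Sym M)` where `x_i` does not vanish. -/
def ratio (i j : Fin 2) : Away (symGrading R M) (SymmetricAlgebra.ι R M (b i)) :=
  Away.isLocalizationElem (ι_mem_symGrading (b i)) (ι_mem_symGrading (b j))

/-- With two basis vectors only one index differs from `i`, so the polynomial ring of
`polyToAway_bijective` has a single variable, sent to the ratio. -/
lemma bijective_eval₂_ratio {i j : Fin 2} (hij : j ≠ i) :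
    Function.Bijective (Polynomial.eval₂RingHom
      (awayBase (SymmetricAlgebra.ι R M (b i))) (ratio b i j)) := by
  let _ : Unique {j // j ≠ i} := ⟨⟨⟨j, hij⟩⟩, fun l => Subtype.ext (by have := l.2; lia)⟩
  have h : (Polynomial.eval₂RingHom (awayBase (SymmetricAlgebra.ι R M (b i))) (ratio b i j)).comp
      (MvPolynomial.uniqueAlgEquiv R {j // j ≠ i}).toRingEquiv.toRingHom =
      polyToAway b i _ rfl := by
    apply MvPolynomial.ringHom_ext
    · intro r
      have hr : MvPolynomial.uniqueAlgEquiv R {j // j ≠ i} (MvPolynomial.C r) = Polynomial.C r :=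
        AlgEquiv.commutes _ r
      simp [polyToAway, hr]
    · intro l
      obtain rfl : l = ⟨j, hij⟩ := Subsingleton.elim _ _
      have hl : MvPolynomial.uniqueAlgEquiv R {j // j ≠ i} (MvPolynomial.X ⟨j, hij⟩) =
        Polynomial.X := MvPolynomial.eval₂_X _ _ _
      simp [polyToAway, hl, ratio, Away.isLocalizationElem]
  have h' := polyToAway_bijective b i _ rfl
  rw [← h, RingHom.coe_comp] at h'
  exact (Function.Bijective.of_comp_iff _
    (MvPolynomial.uniqueAlgEquiv R {j // j ≠ i}).bijective).mp h'

lemma awayMap_ratio_mul (i j : Fin 2) {x : SymmetricAlgebra R M}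
    (hx : x = SymmetricAlgebra.ι R M (b i) * SymmetricAlgebra.ι R M (b j))
    (hx' : x = SymmetricAlgebra.ι R M (b j) * SymmetricAlgebra.ι R M (b i)) :
    awayMap (symGrading R M) (ι_mem_symGrading (b j)) hx (ratio b i j) *
      awayMap (symGrading R M) (ι_mem_symGrading (b i)) hx' (ratio b j i) = 1 := by
  apply val_injective
  simp only [ratio, awayMap_mk, val_mul, val_one, Away.val_mk, Localization.mk_mul]
  rw [← Localization.mk_one, Localization.mk_eq_mk_iff, Localization.r_iff_exists]
  refine ⟨1, ?_⟩
  simp only [OneMemClass.coe_one, one_mul, Submonoid.coe_mul, mul_one, hx]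
  ring

lemma opensRange_congr {X Y : Scheme.{u}} {f g : X ⟶ Y} [IsOpenImmersion f] [IsOpenImmersion g]
    (h : f = g) : f.opensRange = g.opensRange := by
  subst h; rfl

lemma image_inf_image {X Y : Scheme.{u}} (f : X ⟶ Y) [IsOpenImmersion f] (U V : X.Opens) :
    f ''ᵁ U ⊓ f ''ᵁ V = f ''ᵁ (U ⊓ V) :=
  Opens.ext (Set.image_inter f.injective).symm

variable {X : Scheme.{u}} (j : Proj (symGrading R M) ⟶ X)

/-- The chart of an open subscheme `Proj (Sym M)` of `X` where `x_i` does not vanish. -/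
def chart (i : Fin 2) :
    Spec (.of (Away (symGrading R M) (SymmetricAlgebra.ι R M (b i)))) ⟶ X :=
  Proj.awayι (symGrading R M) _ (ι_mem_symGrading (b i)) one_pos ≫ j

lemma chart_comp {C : Scheme.{u}} (π : X ⟶ C) (g : Spec (.of R) ⟶ C)
    (hj : j ≫ π = projToSpec R M ≫ g) (i : Fin 2) :
    chart b j i ≫ π = Spec.map (CommRingCat.ofHom (awayBase _)) ≫ g := by
  rw [chart, Category.assoc, hj, ← Category.assoc, awayι_projToSpec]

/-- The coordinate ring of the overlap of the two charts. -/
abbrev overlap : CommRingCat.{u} :=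
  .of (Away (symGrading R M) (SymmetricAlgebra.ι R M (b 0) * SymmetricAlgebra.ι R M (b 1)))

/-- The restriction from the first chart to the overlap. -/
def toOverlap : .of (Away (symGrading R M) (SymmetricAlgebra.ι R M (b 0))) ⟶ overlap b :=
  CommRingCat.ofHom (awayMap _ (ι_mem_symGrading (b 1)) rfl)

/-- The restriction from the second chart to the overlap. -/
def toOverlap' : .of (Away (symGrading R M) (SymmetricAlgebra.ι R M (b 1))) ⟶ overlap b :=
  CommRingCat.ofHom (awayMap _ (ι_mem_symGrading (b 0)) (mul_comm _ _))

lemma SpecMap_toOverlap : Spec.map (toOverlap b) ≫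
    Proj.awayι (symGrading R M) _ (ι_mem_symGrading (b 0)) one_pos =
      Proj.awayι (symGrading R M) _ (SetLike.mul_mem_graded (ι_mem_symGrading (b 0))
        (ι_mem_symGrading (b 1))) (by norm_num) :=
  Proj.SpecMap_awayMap_awayι _ _ _ _ _

lemma SpecMap_toOverlap' : Spec.map (toOverlap' b) ≫
    Proj.awayι (symGrading R M) _ (ι_mem_symGrading (b 1)) one_pos =
      Proj.awayι (symGrading R M) _ (SetLike.mul_mem_graded (ι_mem_symGrading (b 0))
        (ι_mem_symGrading (b 1))) (by norm_num) :=
  Proj.SpecMap_awayMap_awayι _ _ _ _ _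

instance : IsOpenImmersion (Spec.map (toOverlap b)) := by
  have : IsOpenImmersion (Spec.map (toOverlap b) ≫
      Proj.awayι (symGrading R M) _ (ι_mem_symGrading (b 0)) one_pos) := by
    rw [SpecMap_toOverlap]; infer_instance
  exact IsOpenImmersion.of_comp _
    (Proj.awayι (symGrading R M) _ (ι_mem_symGrading (b 0)) one_pos)

lemma toOverlap_chart :
    Spec.map (toOverlap b) ≫ chart b j 0 = Spec.map (toOverlap' b) ≫ chart b j 1 := by
  rw [chart, chart, ← Category.assoc, ← Category.assoc, SpecMap_toOverlap, SpecMap_toOverlap']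

variable [IsOpenImmersion j]

instance (i : Fin 2) : IsOpenImmersion (chart b j i) := by
  unfold chart; infer_instance

lemma chart_opensRange (i : Fin 2) : (chart b j i).opensRange =
    j ''ᵁ Proj.basicOpen (symGrading R M) (SymmetricAlgebra.ι R M (b i)) := by
  rw [← Proj.opensRange_awayι (symGrading R M) _ (ι_mem_symGrading (b i)) one_pos,
    ← Scheme.Hom.opensRange_comp]
  rfl

lemma chart_preimage_opensRange (i l : Fin 2) :
    chart b j i ⁻¹ᵁ (chart b j l).opensRange = PrimeSpectrum.basicOpen (ratio b i l) := by
  rw [chart_opensRange, chart, Scheme.Hom.comp_preimage, Scheme.Hom.preimage_image_eq]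
  exact Proj.awayι_preimage_basicOpen (symGrading R M) (ι_mem_symGrading (b i)) one_pos
    (ι_mem_symGrading (b l)) one_pos

/-- The charts cover because the basis vectors generate the irrelevant ideal. -/
lemma chart_opensRange_sup :
    (chart b j 0).opensRange ⊔ (chart b j 1).opensRange = j.opensRange := by
  have h : ⨆ i, (chart b j i).opensRange = j.opensRange := by
    simp only [chart_opensRange]
    rw [← Scheme.Hom.image_iSup, Proj.iSup_basicOpen_eq_top _ _ (irrelevant_le_span b b.span_eq),
      Scheme.Hom.image_top_eq_opensRange]
  rw [← h]
  exact le_antisymm (sup_le (le_iSup (fun i => (chart b j i).opensRange) 0)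
    (le_iSup (fun i => (chart b j i).opensRange) 1))
    (iSup_le (Fin.forall_fin_two.mpr ⟨le_sup_left, le_sup_right⟩))

lemma toOverlap_chart_opensRange : (Spec.map (toOverlap b) ≫ chart b j 0).opensRange =
    (chart b j 0).opensRange ⊓ (chart b j 1).opensRange := by
  rw [chart_opensRange, chart_opensRange, image_inf_image, ← Proj.basicOpen_mul,
    ← Proj.opensRange_awayι (symGrading R M) _ (SetLike.mul_mem_graded
      (ι_mem_symGrading (b 0)) (ι_mem_symGrading (b 1))) (by norm_num),
    ← Scheme.Hom.opensRange_comp]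
  exact opensRange_congr (by rw [chart, ← Category.assoc, SpecMap_toOverlap])

end ProjCharts

/-! ### Conclusion for ruled surfaces. -/

section Ruled

open HomogeneousLocalization

variable {k : Type u} [Field k] {X C : Scheme.{u}} (π : X ⟶ C) (c : C ⟶ Spec (.of k))

/-- The coordinates are `t = x₁ / x₀` and `s = x₀ / x₁`, inverse to each other where `x₀ x₁` does
not vanish. -/
theorem etaOn_bijective_of_proj {U : C.Opens} (hU : IsAffineOpen U) {M : Type u} [AddCommGroup M]
    [Module Γ(C, U) M] (b : Module.Basis (Fin 2) Γ(C, U) M)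
    (j : Proj (symGrading Γ(C, U) M) ⟶ X) [IsOpenImmersion j] (hj : j.opensRange = π ⁻¹ᵁ U)
    (hjπ : j ≫ π = projToSpec Γ(C, U) M ≫ hU.fromSpec) :
    Function.Bijective (etaOn π c U) := by
  exact etaOn_bijective_of_charts π c hU (chart b j 0) (chart b j 1) (toOverlap b)
    (toOverlap' b) (toOverlap_chart b j) (toOverlap_chart_opensRange b j)
    (hj ▸ (chart_opensRange_sup b j).symm) (CommRingCat.ofHom (awayBase _))
    (CommRingCat.ofHom (awayBase _)) (chart_comp b j π hU.fromSpec hjπ 0)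
    (chart_comp b j π hU.fromSpec hjπ 1) (ratio b 0 1) (ratio b 1 0)
    (awayMap_ratio_mul b 0 1 rfl (mul_comm _ _)) (chart_preimage_opensRange b j 0 1)
    (bijective_eval₂_ratio b (by simp)) (bijective_eval₂_ratio b (by simp))

variable (E : C.Modules) [IsVectorBundle E 2]

/-- Affine opens with a frame form a basis of `C`. Over each of them the gluing construction embeds
`Proj (Sym E(U))` as the full preimage of `U`, and the isomorphism with `ProjBundle E 2` carries
this to `X`. -/
theorem isIso_eta_of_isRuledSurface (hπ : IsRuledSurface π E) : IsIso (eta π c) := by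
  obtain ⟨e, he⟩ := hπ
  refine isIso_eta_of_basis π c (isBasis_frameOpens E 2) fun U => ?_
  obtain ⟨s, hs⟩ := U.exists_frame
  have hι : IsOpenImmersion (colimit.ι (projGluingData E 2).functor U) :=
    (projGluingData E 2).cover.map_prop U
  have hrange := (projGluingData E 2).toBase_preimage_eq_opensRange_ι U
  have hbase := (projGluingData E 2).ι_toBase U
  let i : Proj (symGrading Γ(C, U.opens) Γ(E, U.opens)) ⟶ ProjBundle E 2 :=
    colimit.ι (projGluingData E 2).functor U
  have hi : IsOpenImmersion i := hι
  have hi' : i.opensRange = ProjBundle.toBase E 2 ⁻¹ᵁ U.opens := by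
    refine hrange.symm.trans ?_
    exact congrArg (ProjBundle.toBase E 2 ⁻¹ᵁ ·) U.opens.opensRange_ι
  have hi'' : i ≫ ProjBundle.toBase E 2 =
      projToSpec Γ(C, U.opens) Γ(E, U.opens) ≫ U.isAffine.fromSpec :=
    hbase.trans (Category.assoc _ _ _)
  refine etaOn_bijective_of_proj π c U.isAffine (hs.basis le_rfl) (i ≫ e.inv) ?_ ?_
  · rw [Scheme.Hom.opensRange_comp, hi', ← he, Scheme.Hom.inv_image]
    rfl
  · rw [← he, Category.assoc, e.inv_hom_id_assoc, hi'']

end Ruled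

end

end RuledSurface

theorem proposition3p4 {k : Type u} [Field k] [IsAlgClosed k] [CharZero k]
    {C : Scheme.{u}} (c : C ⟶ Spec (.of k)) (hC : RuledSurface.IsSmoothProjectiveCurve c)
    (E : C.Modules) [RuledSurface.IsVectorBundle E 2]
    {X : Scheme.{u}} (π : X ⟶ C) (hπ : RuledSurface.IsRuledSurface π E) :
    IsIso (RuledSurface.eta π c) :=
  RuledSurface.isIso_eta_of_isRuledSurface π c E hπ
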